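/- A convex body in $\mathbb{R}^n$ is a compact convex set with nonempty interior. Two sets $C,C'\subset\mathbb{R}^n$ touch if $C\cap C'\neq\emptyset$ and $\operatorname{int}C\cap\operatorname{int}C'=\emptyset$. The touching number $t(C)$ of a convex body $C\subset\mathbb{R}^n$ is the largest $m$ such that there exist $v_1,\dots,v_m\in\mathbb{R}^n$ for which the translates $C+v_i$ and $C+v_j$ touch whenever $i\neq j$. Let $D$ be a convex disc in the $xy$-plane of $\mathbb{R}^3$, that is, a set $D=\{(x,y,0):(x,y)\in D'\}$ with $D'$ a convex body in $\mathbb{R}^2$; let $e=(0,0,1)$, and let $C=\operatorname{conv}(\{e\}\cup D)$ be the truncated cone with base $D$. Then $$t(C)\leq 5,$$ that is, at most five translates of $C$ can touch pairwise. -/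

import Mathlib

/-- A convex body in `ℝⁿ`: a compact convex set with nonempty interior.  In `ℝ²` this is
a convex disc. -/
structure IsConvexBody {n : ℕ} (C : Set (EuclideanSpace ℝ (Fin n))) : Prop where
  isCompact : IsCompact C
  convex : Convex ℝ C
  nonempty_interior : (interior C).Nonempty

/-- Two sets in `ℝⁿ` touch if they meet but their interiors do not. -/
def Touch {n : ℕ} (C C' : Set (EuclideanSpace ℝ (Fin n))) : Prop :=
  (C ∩ C').Nonempty ∧ interior C ∩ interior C' = ∅

/-- The translate `C + v`. -/
def translateBy {n : ℕ} (C : Set (EuclideanSpace ℝ (Fin n))) (v : EuclideanSpace ℝ (Fin n)) :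
    Set (EuclideanSpace ℝ (Fin n)) :=
  (fun x => x + v) '' C

/-- The family `C + v i` is pairwise touching if any two of its members touch. -/
def PairwiseTouching {n : ℕ} (C : Set (EuclideanSpace ℝ (Fin n))) {m : ℕ}
    (v : Fin m → EuclideanSpace ℝ (Fin n)) : Prop :=
  ∀ i j : Fin m, i ≠ j → Touch (translateBy C (v i)) (translateBy C (v j))

/-- The touching number of `C`: the largest `m` such that some family of `m` translates of `C`
is pairwise touching.  It is taken in `ℕ∞`, with value `⊤` if `m` is unbounded; whenever it is
finite the supremum is attained. -/
noncomputable def touchingNumber {n : ℕ} (C : Set (EuclideanSpace ℝ (Fin n))) : ℕ∞ :=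
  sSup {k : ℕ∞ | ∃ m : ℕ, k = (m : ℕ∞) ∧
    ∃ v : Fin m → EuclideanSpace ℝ (Fin n), PairwiseTouching C v}

/-- The inclusion of `ℝ²` into `ℝ³` as the `xy`-plane. -/
noncomputable def xyPlane (p : EuclideanSpace ℝ (Fin 2)) : EuclideanSpace ℝ (Fin 3) :=
  !₂[p 0, p 1, 0]

/-- The point `e = (0, 0, 1)`. -/
noncomputable def apex : EuclideanSpace ℝ (Fin 3) := !₂[0, 0, 1]

/-- The truncated cone `conv ({e} ∪ D)` with base `D` in the `xy`-plane. -/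
noncomputable def truncatedCone (D : Set (EuclideanSpace ℝ (Fin 2))) :
    Set (EuclideanSpace ℝ (Fin 3)) :=
  convexHull ℝ ({apex} ∪ xyPlane '' D)

/-! A plane parallel to a side of the cone is encoded by a planar direction `u`; the matching
functional takes the value `ev i u = L i u + h u * z i` at the `i`-th translation vector, `h` being
the support function of the base. Touching bounds all differences of these values by the width `wd
u`. If two translates differ in height by less than 1, the base of the upper one and the slice of
the lower one at that height have disjoint interiors, and a separating line yields a direction
attaining the bound (`Act`). The upper translate is then maximal and the lower one minimal in that
direction among all translates.

The values are not linear in `u`: a sum of directions loses a nonnegative defect times the height.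
This defect is at most a width, so over height differences below 1 it never cancels a separation.
Hence the three directions of a triple, taken in the order upper-middle, upper-lower, middle-lower,
turn consistently to one side (`triple_pos`), and each triple has an orientation. Four points carry
four orientations. Two of the possible patterns put an extremal direction of one point strictly
between those of another (`not_between_left`, `not_between_right`), or make directions of two
disjoint pairs parallel. The latter forces the base to be a parallelogram, where linear arithmetic
excludes a fifth point (`conflict`). The other patterns fail because of a point above (`not_pmpp`),
a point below (`not_opposite`), or by themselves (`not_pmmm`).

Among six points ordered by height, either the lower five or the upper five span a height below 1,
and the above applies, directly or after reflection in the origin; or two points lie at each end of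
a height range exactly 1, which again forces a parallelogram and excludes any further point. -/

/-! ### Planar brackets -/

/-- A scaled planar determinant; the scale `s` is used to treat mirror images together. -/
def br (s : ℝ) (u v : ℝ × ℝ) : ℝ := s * (u.1 * v.2 - u.2 * v.1)

theorem br_self (s : ℝ) (u : ℝ × ℝ) : br s u u = 0 := by simp only [br]; ring

theorem br_swap (s : ℝ) (u v : ℝ × ℝ) : br s u v = -br s v u := by simp only [br]; ring

theorem br_smul_left (s c : ℝ) (u v : ℝ × ℝ) : br s (c • u) v = c * br s u v := by
  simp only [br, Prod.smul_fst, Prod.smul_snd, smul_eq_mul]; ring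

theorem br_smul_right (s c : ℝ) (u v : ℝ × ℝ) : br s u (c • v) = c * br s u v := by
  simp only [br, Prod.smul_fst, Prod.smul_snd, smul_eq_mul]; ring

theorem br_neg_scale (s : ℝ) (u v : ℝ × ℝ) : br (-s) u v = -br s u v := by
  simp only [br]; ring

theorem br_relation (s : ℝ) (p q r : ℝ × ℝ) :
    br s p q • r = br s r q • p + br s p r • q := by
  ext <;> simp only [br, Prod.smul_fst, Prod.smul_snd, Prod.fst_add, Prod.snd_add, smul_eq_mul] <;>
    ring

theorem br_plucker (s : ℝ) (a d e g : ℝ × ℝ) :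
    br s a d * br s e g - br s a e * br s d g + br s a g * br s d e = 0 := by
  simp only [br]; ring

theorem br_decomp {s : ℝ} {p q : ℝ × ℝ} (h : br s p q ≠ 0) (r : ℝ × ℝ) :
    r = (br s r q / br s p q) • p + (br s p r / br s p q) • q := by
  have := br_relation s p q r
  calc r = (br s p q)⁻¹ • (br s p q • r) := by rw [smul_smul, inv_mul_cancel₀ h, one_smul]
    _ = _ := by
      rw [this, smul_add, smul_smul, smul_smul]
      congr 2 <;> ring

theorem exists_smul_of_br_eq_zero {s : ℝ} (hs : s ≠ 0) {p q : ℝ × ℝ} (hp : p ≠ 0) (hq : q ≠ 0)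
    (h : br s p q = 0) : ∃ l : ℝ, l ≠ 0 ∧ q = l • p := by
  have h0 : p.1 * q.2 - p.2 * q.1 = 0 := by
    rcases mul_eq_zero.1 h with h | h
    · exact absurd h hs
    · exact h
  have key : ∃ l : ℝ, q = l • p := by
    by_cases h1 : p.1 = 0
    · have h2 : p.2 ≠ 0 := fun h2 => hp (Prod.ext h1 h2)
      refine ⟨q.2 / p.2, Prod.ext ?_ ?_⟩
      · have : p.2 * q.1 = 0 := by rw [h1] at h0; linarith
        simp [h1, (mul_eq_zero.1 this).resolve_left h2]
      · simp [h2]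
    · refine ⟨q.1 / p.1, Prod.ext ?_ ?_⟩
      · simp [h1]
      · simp only [Prod.smul_snd, smul_eq_mul]; field_simp; linarith
  obtain ⟨l, hl⟩ := key
  refine ⟨l, ?_, hl⟩
  rintro rfl
  exact hq (by rw [hl, zero_smul])

/-! ### Touching systems -/

/-- The support data of a family of pairwise touching translates of a cone: `h` is the support
function of the base, `L i` and `z i` are the horizontal and vertical parts of the `i`-th
translation vector. -/
structure TouchSystem (ι : Type*) where
  h : ℝ × ℝ → ℝ
  L : ι → (ℝ × ℝ →ₗ[ℝ] ℝ)
  z : ι → ℝ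
  sub' : ∀ u v, h (u + v) ≤ h u + h v
  hom' : ∀ (c : ℝ) u, 0 ≤ c → h (c • u) = c * h u
  wpos' : ∀ u, u ≠ 0 → 0 < h u + h (-u)
  up' : ∀ i j u, z j ≤ z i → (L i u + h u * z i) - (L j u + h u * z j) ≤ h u + h (-u)
  dn' : ∀ i j u, z j ≤ z i →
    (L j u + h u * z j) - (L i u + h u * z i) ≤ (1 - (z i - z j)) * (h u + h (-u))
  le1 : ∀ i j, z i - z j ≤ 1
  act' : ∀ i j, i ≠ j → z j ≤ z i → z i - z j < 1 →
    ∃ u, u ≠ 0 ∧ (L i u + h u * z i) - (L j u + h u * z j) = h u + h (-u)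

namespace TouchSystem

variable {ι : Type*} (S : TouchSystem ι)

/-- The width of the base in direction `u`. -/
def wd (u : ℝ × ℝ) : ℝ := S.h u + S.h (-u)

/-- The value at the `i`-th translation vector of the functional extending `u` that is constant
on the side of the cone facing `u`. -/
def ev (i : ι) (u : ℝ × ℝ) : ℝ := S.L i u + S.h u * S.z i

/-- The direction `u` separates the translates `i` and `j`. -/
def Act (i j : ι) (u : ℝ × ℝ) : Prop := u ≠ 0 ∧ S.ev i u - S.ev j u = S.wd u

theorem h_zero : S.h 0 = 0 := by
  have := S.hom' 0 0 le_rfl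
  simpa using this

theorem wd_zero : S.wd 0 = 0 := by simp [wd, h_zero]

theorem wd_pos {u : ℝ × ℝ} (hu : u ≠ 0) : 0 < S.wd u := S.wpos' u hu

theorem wd_nonneg (u : ℝ × ℝ) : 0 ≤ S.wd u := by
  by_cases hu : u = 0
  · rw [hu, wd_zero]
  · exact (S.wd_pos hu).le

theorem wd_neg (u : ℝ × ℝ) : S.wd (-u) = S.wd u := by
  simp only [wd, neg_neg]; ring

theorem wd_smul {c : ℝ} (hc : 0 ≤ c) (u : ℝ × ℝ) : S.wd (c • u) = c * S.wd u := by
  simp only [wd, ← smul_neg, S.hom' c _ hc]; ring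

theorem ev_smul (i : ι) {c : ℝ} (hc : 0 ≤ c) (u : ℝ × ℝ) : S.ev i (c • u) = c * S.ev i u := by
  simp only [ev, map_smul, S.hom' c _ hc, smul_eq_mul]; ring

theorem ev_neg (i : ι) (u : ℝ × ℝ) : S.ev i (-u) = S.wd u * S.z i - S.ev i u := by
  simp only [ev, wd, map_neg]; ring

theorem ev_add (i : ι) (u v : ℝ × ℝ) :
    S.ev i (u + v) = S.ev i u + S.ev i v - (S.h u + S.h v - S.h (u + v)) * S.z i := by
  simp only [ev, map_add]; ring

theorem up {i j : ι} (hz : S.z j ≤ S.z i) (u : ℝ × ℝ) : S.ev i u - S.ev j u ≤ S.wd u :=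
  S.up' i j u hz

theorem dn {i j : ι} (hz : S.z j ≤ S.z i) (u : ℝ × ℝ) :
    S.ev j u - S.ev i u ≤ (1 - (S.z i - S.z j)) * S.wd u :=
  S.dn' i j u hz

theorem act {i j : ι} (hij : i ≠ j) (hz : S.z j ≤ S.z i) (h1 : S.z i - S.z j < 1) :
    ∃ u, S.Act i j u :=
  S.act' i j hij hz h1

theorem diff_le (i j : ι) (u : ℝ × ℝ) : S.ev i u - S.ev j u ≤ S.wd u := by
  rcases le_total (S.z j) (S.z i) with hz | hz
  · exact S.up hz u
  · have := S.dn hz u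
    nlinarith [S.wd_nonneg u]

/-- Subadditivity applied to `v = (u + v) + (-u)`. Multiplied by a height difference below 1, this
defect stays below one full width. -/
theorem add_sub_le (u v : ℝ × ℝ) : S.h u + S.h v - S.h (u + v) ≤ S.wd u := by
  have := S.sub' (u + v) (-u)
  rw [show u + v + -u = v by abel] at this
  simp only [wd]; linarith

variable {S}

theorem Act.ne_zero {i j : ι} {u : ℝ × ℝ} (h : S.Act i j u) : u ≠ 0 := h.1

theorem Act.eq {i j : ι} {u : ℝ × ℝ} (h : S.Act i j u) : S.ev i u - S.ev j u = S.wd u := h.2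

theorem Act.le_left {i j : ι} {u : ℝ × ℝ} (h : S.Act i j u) (k : ι) : S.ev k u ≤ S.ev i u := by
  linarith [h.eq, S.diff_le k j u]

theorem Act.le_right {i j : ι} {u : ℝ × ℝ} (h : S.Act i j u) (k : ι) : S.ev j u ≤ S.ev k u := by
  linarith [h.eq, S.diff_le i k u]

theorem Act.ne {i j : ι} {u : ℝ × ℝ} (h : S.Act i j u) : i ≠ j := by
  rintro rfl
  linarith [h.eq, S.wd_pos h.ne_zero]

theorem Act.smul {i j : ι} {u : ℝ × ℝ} (h : S.Act i j u) {c : ℝ} (hc : 0 < c) :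
    S.Act i j (c • u) :=
  ⟨smul_ne_zero hc.ne' h.ne_zero, by
    rw [S.ev_smul i hc.le, S.ev_smul j hc.le, S.wd_smul hc.le, ← h.eq]; ring⟩

variable (S)

/-- Reflecting all translation vectors in the origin. -/
def dual : TouchSystem ι where
  h := S.h
  L i := -S.L i
  z i := -S.z i
  sub' := S.sub'
  hom' := S.hom'
  wpos' := S.wpos'
  up' i j u hz := by
    have := S.up' j i u (by linarith)
    simp only [LinearMap.neg_apply]; linarith
  dn' i j u hz := by
    have := S.dn' j i u (by linarith)
    simp only [LinearMap.neg_apply]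
    rw [show -S.z i - -S.z j = S.z j - S.z i by ring]; linarith
  le1 i j := by have := S.le1 j i; linarith
  act' i j hij hz h1 := by
    obtain ⟨u, hu, h⟩ := S.act' j i hij.symm (by linarith) (by linarith)
    exact ⟨u, hu, by simp only [LinearMap.neg_apply]; linarith⟩

theorem dual_z (i : ι) : S.dual.z i = -S.z i := rfl

theorem dual_wd (u : ℝ × ℝ) : S.dual.wd u = S.wd u := rfl

theorem dual_ev (i : ι) (u : ℝ × ℝ) : S.dual.ev i u = -S.ev i u := by
  simp only [ev, dual, LinearMap.neg_apply]; ring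

theorem dual_act {i j : ι} {u : ℝ × ℝ} : S.dual.Act i j u ↔ S.Act j i u := by
  simp only [Act, dual_ev, dual_wd]
  constructor <;> rintro ⟨h, h'⟩ <;> exact ⟨h, by linarith⟩

/-! ### Monotonicity on cones -/

/-- Additivity at one pair spreads to its cone: topping up the smaller coefficient gives a multiple
of `u + v`, and subadditivity yields the missing inequality. -/
theorem h_add_cone {u v : ℝ × ℝ} (huv : S.h u + S.h v ≤ S.h (u + v)) {a b : ℝ} (ha : 0 ≤ a)
    (hb : 0 ≤ b) : S.h (a • u + b • v) = a * S.h u + b * S.h v := by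
  have h1 := S.sub' (a • u) (b • v)
  rw [S.hom' a u ha, S.hom' b v hb] at h1
  apply le_antisymm h1
  rcases le_total a b with hab | hab
  · have h2 := S.sub' (a • u + b • v) ((b - a) • u)
    rw [show a • u + b • v + (b - a) • u = b • (u + v) by module, S.hom' b _ hb,
      S.hom' (b - a) _ (by linarith)] at h2
    nlinarith
  · have h2 := S.sub' (a • u + b • v) ((a - b) • v)
    rw [show a • u + b • v + (a - b) • v = a • (u + v) by module, S.hom' a _ ha,
      S.hom' (a - b) _ (by linarith)] at h2
    nlinarith

variable {S}

/-- The separation contributes a full width, while the defect costs at most that width times a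
height difference below 1. -/
theorem Act.lt_add {i j : ι} {u v : ℝ × ℝ} (hu : S.Act i j u) (hz : S.z j ≤ S.z i)
    (h1 : S.z i - S.z j < 1) (hv : S.ev j v ≤ S.ev i v) : S.ev j (u + v) < S.ev i (u + v) := by
  rw [S.ev_add, S.ev_add]
  have := hu.eq
  have := S.add_sub_le u v
  have := S.wd_pos hu.ne_zero
  nlinarith [S.sub' u v]

/-- A positive combination of a direction separating `j` from the higher `i` with a direction in
which `i` is not below `j` puts `i` strictly above `j`. -/
theorem Act.lt_comb {i j : ι} {u v w : ℝ × ℝ} (hu : S.Act i j u) (hz : S.z j ≤ S.z i)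
    (h1 : S.z i - S.z j < 1) (hv : S.ev j v ≤ S.ev i v) {a b : ℝ} (ha : 0 < a) (hb : 0 ≤ b)
    (hw : w = a • u + b • v) : S.ev j w < S.ev i w := by
  rw [hw]
  apply (hu.smul ha).lt_add hz h1
  rw [S.ev_smul _ hb, S.ev_smul _ hb]
  exact mul_le_mul_of_nonneg_left hv hb

-- The defect is weighted by the height, so passing to a sum of directions lowers the higher point
-- at least as much as the lower one.
variable (S) in
theorem le_comb {i k : ι} {u v w : ℝ × ℝ} (hz : S.z k ≤ S.z i)
    (hu : S.ev i u ≤ S.ev k u) (hv : S.ev i v ≤ S.ev k v) {a b : ℝ} (ha : 0 ≤ a) (hb : 0 ≤ b)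
    (hw : w = a • u + b • v) : S.ev i w ≤ S.ev k w := by
  rw [hw, S.ev_add, S.ev_add, S.ev_smul _ ha, S.ev_smul _ ha, S.ev_smul _ hb, S.ev_smul _ hb]
  have := S.sub' (a • u) (b • v)
  nlinarith

variable (S) in
/-- If the lower `k` is weakly above `i` in two independent directions, it is strictly above `i`
inside the cone they span. -/
theorem lt_of_cone {s : ℝ} {i k : ι} {u v : ℝ × ℝ} (hik : i ≠ k) (hz : S.z k ≤ S.z i)
    (h1 : S.z i - S.z k < 1) (hu : S.ev i u ≤ S.ev k u) (hv : S.ev i v ≤ S.ev k v)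
    (huv : br s u v ≠ 0) : S.ev i (u + v) < S.ev k (u + v) := by
  by_contra hcon
  push Not at hcon
  have hsum : (S.ev k u - S.ev i u) + (S.ev k v - S.ev i v)
      + (S.h u + S.h v - S.h (u + v)) * (S.z i - S.z k) ≤ 0 := by
    rw [S.ev_add, S.ev_add] at hcon
    linarith
  have hk : 0 ≤ S.h u + S.h v - S.h (u + v) := by linarith [S.sub' u v]
  have hp : 0 ≤ (S.h u + S.h v - S.h (u + v)) * (S.z i - S.z k) :=
    mul_nonneg hk (by linarith)
  have hu0 : S.ev k u = S.ev i u := by linarith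
  have hv0 : S.ev k v = S.ev i v := by linarith
  have hp0 : (S.h u + S.h v - S.h (u + v)) * (S.z i - S.z k) = 0 := by linarith
  -- In the equality case either `h` is additive on the cone or the heights agree, so `i` and `k`
  -- are level on the whole cone.
  have hcone : ∀ a b : ℝ, 0 ≤ a → 0 ≤ b → S.ev k (a • u + b • v) = S.ev i (a • u + b • v) := by
    intro a b ha hb
    rw [S.ev_add, S.ev_add, S.ev_smul _ ha, S.ev_smul _ ha, S.ev_smul _ hb, S.ev_smul _ hb,
      hu0, hv0]
    rcases mul_eq_zero.1 hp0 with h | h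
    · rw [S.h_add_cone (by linarith) ha hb, S.hom' a u ha, S.hom' b v hb]; ring
    · rw [show S.z i = S.z k by linarith]
  obtain ⟨y, hy⟩ := S.act hik hz h1
  obtain ⟨a, b, hab⟩ : ∃ a b : ℝ, y = a • u + b • v := ⟨_, _, br_decomp huv y⟩
  -- Adding the negative parts of `a` and `b` moves the separating direction `y` into the cone and
  -- keeps `i` strictly above `k`.
  have hlt := hy.lt_add hz h1 (hcone (max (-a) 0) (max (-b) 0) (le_max_right _ _)
    (le_max_right _ _)).le
  have heq := hcone (max a 0) (max b 0) (le_max_right _ _) (le_max_right _ _)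
  have hmax : ∀ x : ℝ, x + max (-x) 0 = max x 0 := fun x => by
    rcases le_total x 0 with hx | hx
    · rw [max_eq_left (by linarith), max_eq_right hx]; ring
    · rw [max_eq_right (by linarith), max_eq_left hx]; ring
  rw [hab, show a • u + b • v + (max (-a) 0 • u + max (-b) 0 • v)
    = (a + max (-a) 0) • u + (b + max (-b) 0) • v by module, hmax, hmax] at hlt
  linarith

variable (S) in
theorem lt_of_between {s : ℝ} {i k : ι} {u v w : ℝ × ℝ} (hik : i ≠ k) (hz : S.z k ≤ S.z i)
    (h1 : S.z i - S.z k < 1) (hu : S.ev i u ≤ S.ev k u) (hv : S.ev i v ≤ S.ev k v)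
    (huw : 0 < br s u w) (hwv : 0 < br s w v) (huv : 0 < br s u v) : S.ev i w < S.ev k w := by
  have hw := br_decomp huv.ne' w
  have ha : 0 < br s w v / br s u v := div_pos hwv huv
  have hb : 0 < br s u w / br s u v := div_pos huw huv
  rw [hw]
  refine S.lt_of_cone (s := s) hik hz h1 ?_ ?_ ?_
  · rw [S.ev_smul _ ha.le, S.ev_smul _ ha.le]; exact mul_le_mul_of_nonneg_left hu ha.le
  · rw [S.ev_smul _ hb.le, S.ev_smul _ hb.le]; exact mul_le_mul_of_nonneg_left hv hb.le
  · rw [br_smul_left, br_smul_right]; positivity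

/-- No direction topped by the higher `i` lies strictly between two directions topped by the
lower `k`. -/
theorem not_between_left {s : ℝ} {i k p q r : ι} {u v w : ℝ × ℝ} (hu : S.Act k p u)
    (hv : S.Act k q v) (hw : S.Act i r w) (hik : i ≠ k) (hz : S.z k ≤ S.z i)
    (h1 : S.z i - S.z k < 1)
    (huw : 0 < br s u w) (hwv : 0 < br s w v) (huv : 0 < br s u v) : False :=
  absurd (S.lt_of_between hik hz h1 (hu.le_left i) (hv.le_left i) huw hwv huv)
    (not_lt.2 (hw.le_left k))

/-- Reflection in the origin exchanges higher with lower and maximal with minimal. -/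
theorem not_between_right {s : ℝ} {i k p q r : ι} {u v w : ℝ × ℝ} (hu : S.Act p k u)
    (hv : S.Act q k v) (hw : S.Act r i w) (hik : i ≠ k) (hz : S.z i ≤ S.z k)
    (h1 : S.z k - S.z i < 1)
    (huw : 0 < br s u w) (hwv : 0 < br s w v) (huv : 0 < br s u v) : False :=
  not_between_left (S := S.dual) (S.dual_act.2 hu) (S.dual_act.2 hv) (S.dual_act.2 hw) hik
    (by simpa only [dual_z, neg_le_neg_iff] using hz) (by simp only [dual_z]; linarith)
    huw hwv huv

/-! ### Triples -/

/-- Directions separating three points pairwise do not balance. -/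
theorem triple_balance {i j k : ι} {p q r : ℝ × ℝ} (hp : S.Act i j p) (hq : S.Act i k q)
    (hr : S.Act j k r) (hij : S.z j ≤ S.z i) (hjk : S.z k ≤ S.z j) (h1 : S.z i - S.z k < 1)
    {a b c : ℝ} (ha : 0 ≤ a) (hb : 0 < b) (hc : 0 ≤ c) :
    a • p + b • q + c • r ≠ 0 := by
  intro h0
  set P := a • p with hP
  set Q := b • q with hQ
  set R := c • r with hR
  have eP : S.ev i P - S.ev j P = S.wd P := by
    rw [hP, S.ev_smul _ ha, S.ev_smul _ ha, S.wd_smul ha, ← hp.eq]; ring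
  have eQ : S.ev i Q - S.ev k Q = S.wd Q := (hq.smul hb).eq
  have eR : S.ev j R - S.ev k R = S.wd R := by
    rw [hR, S.ev_smul _ hc, S.ev_smul _ hc, S.wd_smul hc, ← hr.eq]; ring
  have dP := S.dn hjk P
  have dR := S.dn hij R
  have wQ := S.wd_pos (hq.smul hb).ne_zero
  -- As `P + Q + R = 0`, the linear parts cancel. The left side is at least `wd Q` plus `wd P` and
  -- `wd R` weighted by the lower and the upper height gap; `m1` and `m2` bound the right side by
  -- the same expression with `wd Q` scaled by a factor below 1.
  have hsum : (S.ev i P - S.ev k P) + (S.ev i Q - S.ev k Q) + (S.ev i R - S.ev k R)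
      = (S.h P + S.h Q + S.h R) * (S.z i - S.z k) := by
    have e1 : S.L i P + S.L i Q + S.L i R = 0 := by rw [← map_add, ← map_add, h0, map_zero]
    have e2 : S.L k P + S.L k Q + S.L k R = 0 := by rw [← map_add, ← map_add, h0, map_zero]
    simp only [ev]
    linear_combination e1 - e2
  have k1 := S.add_sub_le Q R
  have k2 := S.add_sub_le Q P
  rw [show Q + R = -P by rw [← sub_eq_zero, ← h0]; abel] at k1
  rw [show Q + P = -R by rw [← sub_eq_zero, ← h0]; abel] at k2
  have m1 : S.h P + S.h Q + S.h R ≤ S.wd P + S.wd Q := by simp only [wd] at k1 ⊢; linarith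
  have m2 : S.h P + S.h Q + S.h R ≤ S.wd R + S.wd Q := by simp only [wd] at k2 ⊢; linarith
  have n1 := mul_le_mul_of_nonneg_right m1 (show 0 ≤ S.z j - S.z k by linarith)
  have n2 := mul_le_mul_of_nonneg_right m2 (show 0 ≤ S.z i - S.z j by linarith)
  nlinarith

/-- Three brackets of consistent orientation. -/
def Pos (s : ℝ) (p q r : ℝ × ℝ) : Prop :=
  0 ≤ br s p q ∧ 0 ≤ br s q r ∧ 0 ≤ br s p r ∧ 0 < br s p q + br s q r

end TouchSystem

namespace TouchSystem

variable {ι : Type*} {S : TouchSystem ι}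

theorem Pos.neg {s : ℝ} {p q r : ℝ × ℝ} (h : Pos (-s) p q r) :
    br s p q ≤ 0 ∧ br s q r ≤ 0 ∧ br s p r ≤ 0 ∧ br s p q + br s q r < 0 := by
  simp only [Pos, br_neg_scale] at h
  obtain ⟨h1, h2, h3, h4⟩ := h
  refine ⟨?_, ?_, ?_, ?_⟩ <;> linarith

section triple

variable {i j k : ι} {p q r : ℝ × ℝ}

theorem triple_parallel_left (hp : S.Act i j p) (hq : S.Act i k q)
    (hr : S.Act j k r) (hij : S.z j ≤ S.z i) (hjk : S.z k ≤ S.z j) (h1 : S.z i - S.z k < 1)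
    {s : ℝ} (hs : s ≠ 0) (h : br s p q = 0) : ∃ l : ℝ, 0 < l ∧ q = l • p := by
  obtain ⟨l, hl, hpq⟩ := exists_smul_of_br_eq_zero hs hp.ne_zero hq.ne_zero h
  rcases lt_or_gt_of_ne hl with hl | hl
  · exact absurd (by rw [hpq]; module)
      (triple_balance hp hq hr hij hjk h1 (neg_nonneg.2 hl.le) one_pos le_rfl)
  · exact ⟨l, hl, hpq⟩

theorem triple_parallel_right (hp : S.Act i j p) (hq : S.Act i k q)
    (hr : S.Act j k r) (hij : S.z j ≤ S.z i) (hjk : S.z k ≤ S.z j) (h1 : S.z i - S.z k < 1)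
    {s : ℝ} (hs : s ≠ 0) (h : br s q r = 0) : ∃ l : ℝ, 0 < l ∧ r = l • q := by
  obtain ⟨l, hl, hqr⟩ := exists_smul_of_br_eq_zero hs hq.ne_zero hr.ne_zero h
  rcases lt_or_gt_of_ne hl with hl | hl
  · exact absurd (by rw [hqr]; module)
      (triple_balance hp hq hr hij hjk h1 le_rfl (neg_pos.2 hl) zero_le_one)
  · exact ⟨l, hl, hqr⟩

/-- If `q` left the cone of `p` and `r`, the three-term bracket relation would either balance the
directions or write `p` (or `r`) as a positive combination in which `j` beats `k` (or `i` beats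
`j`), against the extremality of `j`. -/
theorem triple_pos_of_pos (hp : S.Act i j p) (hq : S.Act i k q)
    (hr : S.Act j k r) (hij : S.z j ≤ S.z i) (hjk : S.z k ≤ S.z j) (h1 : S.z i - S.z k < 1)
    {s : ℝ} (h : 0 < br s p r) : Pos s p q r := by
  have rel := br_relation s p q r
  rw [br_swap s r q] at rel
  have hbal := fun a b c ha hb hc => triple_balance hp hq hr hij hjk h1 (a := a) (b := b) (c := c)
    ha hb hc
  have hx : 0 ≤ br s p q := by
    by_contra! hx
    rcases le_or_gt (br s q r) 0 with hy | hy
    · refine hbal (-br s q r) (br s p r) (-br s p q) (by linarith) h (by linarith) ?_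
      rw [neg_smul _ r, rel]; abel
    · have := hr.lt_comb (w := br s q r • p) (v := q) (a := -br s p q) (b := br s p r)
        hjk (by linarith) (hq.le_right j) (by linarith) h.le
        (by rw [neg_smul _ r, rel]; module)
      exact absurd this (not_lt.2 ((hp.smul hy).le_right k))
  have hy : 0 ≤ br s q r := by
    by_contra! hy
    rcases hx.eq_or_lt with hx | hx
    · refine hbal (-br s q r) (br s p r) (-br s p q) (by linarith) h (by linarith) ?_
      rw [neg_smul _ r, rel]; abel
    · have := hp.lt_comb (w := br s p q • r) (v := q) (a := -br s q r) (b := br s p r)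
        hij (by linarith) (hq.le_left j) (by linarith) h.le (by rw [rel])
      exact absurd this (not_lt.2 ((hr.smul hx).le_left i))
  refine ⟨hx, hy, h.le, ?_⟩
  by_contra! hxy
  refine hbal (-br s q r) (br s p r) (-br s p q) (by linarith) h (by linarith) ?_
  rw [neg_smul _ r, rel]; abel

theorem triple_pos (hp : S.Act i j p) (hq : S.Act i k q)
    (hr : S.Act j k r) (hij : S.z j ≤ S.z i) (hjk : S.z k ≤ S.z j) (h1 : S.z i - S.z k < 1)
    {s : ℝ} (hs : s ≠ 0) : Pos s p q r ∨ Pos (-s) p q r := by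
  rcases lt_trichotomy (br s p r) 0 with h | h | h
  · exact Or.inr (triple_pos_of_pos hp hq hr hij hjk h1
      (by rw [br_neg_scale]; linarith))
  -- Here `p` and `r` are antiparallel, and the side of their line containing `q` decides the
  -- orientation.
  · obtain ⟨l, hl, hpr⟩ := exists_smul_of_br_eq_zero hs hp.ne_zero hr.ne_zero h
    have hl : l < 0 := by
      by_contra! hl'
      have hl' := lt_of_le_of_ne hl' hl.symm
      have h2 := hr.le_left i
      have h3 := (hp.smul hl')
      rw [← hpr] at h3
      linarith [h3.eq, S.wd_pos h3.ne_zero]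
    have hqr : br s q r = -l * br s p q := by rw [hpr, br_smul_right, br_swap]; ring
    have hne : br s p q ≠ 0 := by
      intro h0
      obtain ⟨m, hm, hq'⟩ := triple_parallel_left hp hq hr hij hjk h1 hs h0
      refine triple_balance hp hq hr hij hjk h1 le_rfl (neg_pos.2 hl) hm.le ?_
      rw [hq', hpr]; module
    rcases lt_or_gt_of_ne hne with h0 | h0
    · refine Or.inr ⟨?_, ?_, ?_, ?_⟩ <;> simp only [br_neg_scale, hqr, h] <;> nlinarith
    · refine Or.inl ⟨h0.le, ?_, h.ge, ?_⟩ <;> rw [hqr] <;> nlinarith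
  · exact Or.inl (triple_pos_of_pos hp hq hr hij hjk h1 h)

end triple

/-! ### Additivity of the support function and boxes -/

/-- The width bound at `u + v` makes the defect at `(-u, -v)` plus `1 - (z i - z j)` times the
defect at `(u, v)` nonpositive. Both are nonnegative; with height difference below 1 the defect at
`(u, v)` vanishes too. -/
theorem Act.h_neg_add {i j : ι} {u v : ℝ × ℝ} (hu : S.Act i j u) (hv : S.Act i j v) :
    S.h (-u) + S.h (-v) ≤ S.h (-u + -v) := by
  have h1 := S.diff_le i j (u + v)
  rw [S.ev_add, S.ev_add] at h1
  have := hu.eq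
  have := hv.eq
  simp only [wd, neg_add] at *
  nlinarith [S.sub' u v, S.le1 i j]

theorem Act.h_add {i j : ι} {u v : ℝ × ℝ} (hu : S.Act i j u) (hv : S.Act i j v)
    (h1 : S.z i - S.z j < 1) : S.h u + S.h v ≤ S.h (u + v) := by
  have h2 := S.diff_le i j (u + v)
  rw [S.ev_add, S.ev_add] at h2
  have := hu.eq
  have := hv.eq
  have := S.sub' (-u) (-v)
  simp only [wd, neg_add] at *
  by_contra! h3
  nlinarith

variable (S) in
/-- The base is, up to affine equivalence, a box with normals `±u`, `±v`, as far as its support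
function in the four quadrants spanned by them is concerned. -/
structure Box (u v : ℝ × ℝ) : Prop where
  ne : br 1 u v ≠ 0
  pp : S.h u + S.h v ≤ S.h (u + v)
  pn : S.h u + S.h (-v) ≤ S.h (u + -v)
  np : S.h (-u) + S.h v ≤ S.h (-u + v)
  nn : S.h (-u) + S.h (-v) ≤ S.h (-u + -v)

variable (S) in
/-- Normalised value of a translation vector. -/
noncomputable def nv (i : ι) (u : ℝ × ℝ) : ℝ := S.ev i u / S.wd u

theorem nv_neg (i : ι) {u : ℝ × ℝ} (hu : u ≠ 0) : S.nv i (-u) = S.z i - S.nv i u := by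
  have := (S.wd_pos hu).ne'
  simp only [nv, wd_neg, ev_neg]
  field_simp

theorem nv_sub_le (i j : ι) {u : ℝ × ℝ} (hu : u ≠ 0) : S.nv i u - S.nv j u ≤ 1 := by
  rw [nv, nv, ← sub_div, div_le_one (S.wd_pos hu)]
  exact S.diff_le i j u

theorem nv_sub_le_neg (i j : ι) {u : ℝ × ℝ} (hu : u ≠ 0) :
    (S.z i - S.nv i u) - (S.z j - S.nv j u) ≤ 1 := by
  rw [← nv_neg i hu, ← nv_neg j hu]
  exact nv_sub_le i j (neg_ne_zero.2 hu)

theorem act_iff_nv {i j : ι} {u : ℝ × ℝ} (hu : u ≠ 0) :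
    S.Act i j u ↔ S.nv i u - S.nv j u = 1 := by
  rw [nv, nv, ← sub_div, div_eq_one_iff_eq (S.wd_pos hu).ne', Act]
  exact and_iff_right hu

theorem Act.nv_eq {i j : ι} {u : ℝ × ℝ} (h : S.Act i j u) : S.nv i u - S.nv j u = 1 :=
  (act_iff_nv h.ne_zero).1 h

/-- Under additivity the slack in the width bound splits as a nonnegative combination of the slacks
at `u` and `v`, so it vanishes termwise. Inside a quadrant of a box, separation is thus already
achieved by a normal. -/
theorem act_of_act_comb {i j : ι} {u v : ℝ × ℝ} (hu : u ≠ 0) (hv : v ≠ 0)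
    (hp : S.h u + S.h v ≤ S.h (u + v))
    (hn : S.h (-u) + S.h (-v) ≤ S.h (-u + -v)) {a b : ℝ} (ha : 0 ≤ a) (hb : 0 ≤ b)
    (h : S.Act i j (a • u + b • v)) : S.Act i j u ∨ S.Act i j v := by
  have e := h.eq
  have hw : S.wd (a • u + b • v) = a * S.wd u + b * S.wd v := by
    have e1 := S.h_add_cone hp ha hb
    have e2 := S.h_add_cone hn ha hb
    simp only [wd, e1, show -(a • u + b • v) = a • -u + b • -v by module, e2]; ring
  rw [hw, S.ev_add, S.ev_add, S.h_add_cone hp ha hb, S.hom' a _ ha, S.hom' b _ hb,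
    S.ev_smul _ ha, S.ev_smul _ ha, S.ev_smul _ hb, S.ev_smul _ hb] at e
  have du := S.diff_le i j u
  have dv := S.diff_le i j v
  have e1 : a * (S.wd u - (S.ev i u - S.ev j u)) = 0 := by
    nlinarith [mul_nonneg ha (sub_nonneg.2 du), mul_nonneg hb (sub_nonneg.2 dv)]
  have e2 : b * (S.wd v - (S.ev i v - S.ev j v)) = 0 := by
    nlinarith [mul_nonneg ha (sub_nonneg.2 du), mul_nonneg hb (sub_nonneg.2 dv)]
  rcases mul_eq_zero.1 e1 with h1 | h1
  · rcases mul_eq_zero.1 e2 with h2 | h2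
    · exact absurd (by rw [h1, h2]; simp) h.ne_zero
    · exact Or.inr ⟨hv, by linarith⟩
  · exact Or.inl ⟨hu, by linarith⟩

theorem Box.left_ne {u v : ℝ × ℝ} (hB : S.Box u v) : u ≠ 0 := by
  rintro rfl; exact hB.ne (by simp [br])

theorem Box.right_ne {u v : ℝ × ℝ} (hB : S.Box u v) : v ≠ 0 := by
  rintro rfl; exact hB.ne (by simp [br])

theorem Box.cases {u v : ℝ × ℝ} (hB : S.Box u v) {i j : ι} (hij : i ≠ j) (hz : S.z j ≤ S.z i)
    (h1 : S.z i - S.z j < 1) :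
    S.nv i u - S.nv j u = 1 ∨ S.nv i v - S.nv j v = 1 ∨
    (S.z i - S.nv i u) - (S.z j - S.nv j u) = 1 ∨
    (S.z i - S.nv i v) - (S.z j - S.nv j v) = 1 := by
  have hu := hB.left_ne
  have hv := hB.right_ne
  have hu' := neg_ne_zero.2 hu
  have hv' := neg_ne_zero.2 hv
  rw [← nv_neg i hu, ← nv_neg j hu, ← nv_neg i hv, ← nv_neg j hv, ← act_iff_nv hu, ← act_iff_nv hv,
    ← act_iff_nv hu', ← act_iff_nv hv']
  obtain ⟨y, hy⟩ := S.act hij hz h1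
  obtain ⟨a, b, rfl⟩ : ∃ a b : ℝ, y = a • u + b • v := ⟨_, _, br_decomp hB.ne y⟩
  rcases le_total 0 a with ha | ha <;> rcases le_total 0 b with hb | hb
  · have := act_of_act_comb hu hv hB.pp hB.nn ha hb hy
    tauto
  · have := act_of_act_comb (a := a) (b := -b) hu hv' hB.pn (by simpa using hB.np) ha (by linarith)
      (by rwa [show a • u + -b • -v = a • u + b • v by module])
    tauto
  · have := act_of_act_comb (a := -a) (b := b) hu' hv hB.np (by simpa using hB.pn) (by linarith) hb
      (by rwa [show -a • -u + b • v = a • u + b • v by module])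
    tauto
  · have := act_of_act_comb (a := -a) (b := -b) hu' hv' hB.nn (by simpa using hB.pp) (by linarith)
      (by linarith) (by rwa [show -a • -u + -b • -v = a • u + b • v by module])
    tauto

theorem Box.cases' {u v : ℝ × ℝ} (hB : S.Box u v) {i j : ι} (hij : i ≠ j)
    (h1 : S.z i - S.z j < 1) (h2 : S.z j - S.z i < 1) :
    (S.z j ≤ S.z i ∧ (S.nv i u - S.nv j u = 1 ∨ S.nv i v - S.nv j v = 1 ∨
      (S.z i - S.nv i u) - (S.z j - S.nv j u) = 1 ∨
      (S.z i - S.nv i v) - (S.z j - S.nv j v) = 1)) ∨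
    (S.z i ≤ S.z j ∧ (S.nv j u - S.nv i u = 1 ∨ S.nv j v - S.nv i v = 1 ∨
      (S.z j - S.nv j u) - (S.z i - S.nv i u) = 1 ∨
      (S.z j - S.nv j v) - (S.z i - S.nv i v) = 1)) := by
  rcases le_total (S.z j) (S.z i) with hz | hz
  · exact Or.inl ⟨hz, hB.cases hij hz h1⟩
  · exact Or.inr ⟨hz, hB.cases hij.symm hz h2⟩

set_option maxHeartbeats 2000000 in
/-- In normalised box coordinates, four points in conflict whose upper and lower pairs are
separated in opposite directions leave no room for a fifth. -/
theorem no_fifth_of_opposite_sides {ι : Type*} {A X z : ι → ℝ} {i j k l m : ι} (zij : z j ≤ z i)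
    (zjk : z k ≤ z j) (zkl : z l ≤ z k) (h1 : z i - z l < 1) (h2 : z i - z m < 1)
    (h3 : z m - z l < 1) (bA : ∀ p q, A p - A q ≤ 1) (bX : ∀ p q, X p - X q ≤ 1)
    (bA' : ∀ p q, (z p - A p) - (z q - A q) ≤ 1) (bX' : ∀ p q, (z p - X p) - (z q - X q) ≤ 1)
    (na : A i - A j = 1) (xik : X i - X k = 1) (xil : X i - X l = 1) (xjk : X j - X k = 1)
    (ng : (z k - A k) - (z l - A l) = 1)
    (ci : (z i ≤ z m ∧ (A m - A i = 1 ∨ X m - X i = 1 ∨ (z m - A m) - (z i - A i) = 1 ∨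
        (z m - X m) - (z i - X i) = 1)) ∨
      (z m ≤ z i ∧ (A i - A m = 1 ∨ X i - X m = 1 ∨ (z i - A i) - (z m - A m) = 1 ∨
        (z i - X i) - (z m - X m) = 1)))
    (cj : (z j ≤ z m ∧ (A m - A j = 1 ∨ X m - X j = 1 ∨ (z m - A m) - (z j - A j) = 1 ∨
        (z m - X m) - (z j - X j) = 1)) ∨
      (z m ≤ z j ∧ (A j - A m = 1 ∨ X j - X m = 1 ∨ (z j - A j) - (z m - A m) = 1 ∨
        (z j - X j) - (z m - X m) = 1)))
    (ck : (z k ≤ z m ∧ (A m - A k = 1 ∨ X m - X k = 1 ∨ (z m - A m) - (z k - A k) = 1 ∨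
        (z m - X m) - (z k - X k) = 1)) ∨
      (z m ≤ z k ∧ (A k - A m = 1 ∨ X k - X m = 1 ∨ (z k - A k) - (z m - A m) = 1 ∨
        (z k - X k) - (z m - X m) = 1)))
    (cl : (z l ≤ z m ∧ (A m - A l = 1 ∨ X m - X l = 1 ∨ (z m - A m) - (z l - A l) = 1 ∨
        (z m - X m) - (z l - X l) = 1)) ∨
      (z m ≤ z l ∧ (A l - A m = 1 ∨ X l - X m = 1 ∨ (z l - A l) - (z m - A m) = 1 ∨
        (z l - X l) - (z m - X m) = 1))) : False := by
  -- The width bounds force `j` and `k` to equal height and fix all relative horizontal coordinates;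
  -- what remains is linear arithmetic over the sides on which `m` is separated.
  obtain ⟨ekj, zz, eil, ei, xj, xi, xl⟩ : A k = A j ∧ z k = z j ∧ A l = A j + 1 + z l - z j ∧ A i = A j + 1 ∧
      X j = X k + 1 ∧ X i = X k + 1 ∧ X l = X k := by
    refine ⟨?_, ?_, ?_, ?_, ?_, ?_, ?_⟩ <;>
      linarith [bA i k, bA l j, bA' j l, bA' k i, bA j k, bA k j, bA' k j, bA' j k, bX i l, bA i l]
  have u1 := bA i m
  have u2 := bX i m
  have u3 := bX m k
  have u4 := bA m j
  have u5 := bA' i m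
  have u6 := bX' i m
  have u7 := bA' m j
  have u8 := bX' m k
  have u9 := bA m l
  have u10 := bX' m l
  have u11 := bA' m k
  have u12 := bA' m l
  have u13 := bX' m j
  have u14 := bA k m
  have u15 := bA' j m
  clear bA bX bA' bX' na xik xil xjk ng
  generalize A i = Ai at *
  generalize A j = Aj at *
  generalize A k = Ak at *
  generalize A l = Al at *
  generalize A m = Am at *
  generalize X i = Xi at *
  generalize X j = Xj at *
  generalize X k = Xk at *
  generalize X l = Xl at *
  generalize X m = Xm at *
  generalize z i = zi at *
  generalize z j = zj at *
  generalize z k = zk at *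
  generalize z l = zl at *
  generalize z m = zm at *
  subst ekj zz eil ei xj xi xl
  rcases cj with ⟨hj, cj | cj | cj | cj⟩ | ⟨hj, cj | cj | cj | cj⟩ <;> try linarith
  all_goals
    rcases ck with ⟨hk, ck | ck | ck | ck⟩ | ⟨hk, ck | ck | ck | ck⟩ <;> try linarith
  all_goals
    rcases ci with ⟨hi, ci | ci | ci | ci⟩ | ⟨hi, ci | ci | ci | ci⟩ <;> try linarith
  all_goals
    rcases cl with ⟨hl, cl | cl | cl | cl⟩ | ⟨hl, cl | cl | cl | cl⟩ <;> linarith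

set_option maxHeartbeats 2000000 in
/-- In normalised box coordinates, four points in conflict whose upper and lower pairs are
separated in the same direction leave no room for a fifth. -/
theorem no_fifth_of_same_side {ι : Type*} {A X z : ι → ℝ} {i j k l m : ι} (zij : z j ≤ z i)
    (zjk : z k ≤ z j) (zkl : z l ≤ z k) (h1 : z i - z l < 1) (h2 : z i - z m < 1)
    (h3 : z m - z l < 1) (bA : ∀ p q, A p - A q ≤ 1) (bX : ∀ p q, X p - X q ≤ 1)
    (bA' : ∀ p q, (z p - A p) - (z q - A q) ≤ 1) (bX' : ∀ p q, (z p - X p) - (z q - X q) ≤ 1)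
    (na : A i - A j = 1) (xik : X i - X k = 1) (xil : X i - X l = 1) (xjk : X j - X k = 1)
    (ng : A k - A l = 1)
    (ci : (z i ≤ z m ∧ (A m - A i = 1 ∨ X m - X i = 1 ∨ (z m - A m) - (z i - A i) = 1 ∨
        (z m - X m) - (z i - X i) = 1)) ∨
      (z m ≤ z i ∧ (A i - A m = 1 ∨ X i - X m = 1 ∨ (z i - A i) - (z m - A m) = 1 ∨
        (z i - X i) - (z m - X m) = 1)))
    (cj : (z j ≤ z m ∧ (A m - A j = 1 ∨ X m - X j = 1 ∨ (z m - A m) - (z j - A j) = 1 ∨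
        (z m - X m) - (z j - X j) = 1)) ∨
      (z m ≤ z j ∧ (A j - A m = 1 ∨ X j - X m = 1 ∨ (z j - A j) - (z m - A m) = 1 ∨
        (z j - X j) - (z m - X m) = 1)))
    (ck : (z k ≤ z m ∧ (A m - A k = 1 ∨ X m - X k = 1 ∨ (z m - A m) - (z k - A k) = 1 ∨
        (z m - X m) - (z k - X k) = 1)) ∨
      (z m ≤ z k ∧ (A k - A m = 1 ∨ X k - X m = 1 ∨ (z k - A k) - (z m - A m) = 1 ∨
        (z k - X k) - (z m - X m) = 1)))
    (cl : (z l ≤ z m ∧ (A m - A l = 1 ∨ X m - X l = 1 ∨ (z m - A m) - (z l - A l) = 1 ∨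
        (z m - X m) - (z l - X l) = 1)) ∨
      (z m ≤ z l ∧ (A l - A m = 1 ∨ X l - X m = 1 ∨ (z l - A l) - (z m - A m) = 1 ∨
        (z l - X l) - (z m - X m) = 1))) : False := by
  obtain ⟨ekj, zz, eil, ei, xj, xi, xl⟩ : A k = A j + 1 ∧ z k = z j ∧ A l = A j ∧ A i = A j + 1 ∧
      X j = X k + 1 ∧ X i = X k + 1 ∧ X l = X k := by
    refine ⟨?_, ?_, ?_, ?_, ?_, ?_, ?_⟩ <;>
      linarith [bA i k, bA l j, bA' j l, bA' k i, bA j k, bA k j, bA' k j, bA' j k, bX i l, bA i l]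
  have u1 := bA i m
  have u2 := bX i m
  have u3 := bX m k
  have u4 := bA m j
  have u5 := bA' i m
  have u6 := bX' i m
  have u7 := bA' m j
  have u8 := bX' m k
  have u9 := bA m l
  have u10 := bX' m l
  have u11 := bA' m k
  have u12 := bA' m l
  have u13 := bX' m j
  have u14 := bA k m
  have u15 := bA' j m
  clear bA bX bA' bX' na xik xil xjk ng
  generalize A i = Ai at *
  generalize A j = Aj at *
  generalize A k = Ak at *
  generalize A l = Al at *
  generalize A m = Am at *
  generalize X i = Xi at *
  generalize X j = Xj at *
  generalize X k = Xk at *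
  generalize X l = Xl at *
  generalize X m = Xm at *
  generalize z i = zi at *
  generalize z j = zj at *
  generalize z k = zk at *
  generalize z l = zl at *
  generalize z m = zm at *
  subst ekj zz eil ei xj xi xl
  rcases cj with ⟨hj, cj | cj | cj | cj⟩ | ⟨hj, cj | cj | cj | cj⟩ <;> try linarith
  all_goals
    rcases ck with ⟨hk, ck | ck | ck | ck⟩ | ⟨hk, ck | ck | ck | ck⟩ <;> try linarith
  all_goals
    rcases ci with ⟨hi, ci | ci | ci | ci⟩ | ⟨hi, ci | ci | ci | ci⟩ <;> try linarith
  all_goals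
    rcases cl with ⟨hl, cl | cl | cl | cl⟩ | ⟨hl, cl | cl | cl | cl⟩ <;> linarith

/-! ### ### Conflict configurations -/

section conflict

variable {i j k l m : ι} {x : ℝ × ℝ}

theorem conflict_balance {a g : ℝ × ℝ} (ha : S.Act i j a) (hx : S.Act i l x) (hg : S.Act k l g)
    (zij : S.z j ≤ S.z i) (zjk : S.z k ≤ S.z j) (zkl : S.z l ≤ S.z k) (h1 : S.z i - S.z l < 1)
    {α β γ : ℝ} (hα : 0 < α) (hβ : 0 < β) (hγ : 0 < γ) (h0 : α • a + β • x + γ • g = 0) :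
    False := by
  have eP := (ha.smul hα).eq
  have eQ := (hx.smul hβ).eq
  have eR := (hg.smul hγ).eq
  have wQ := S.wd_pos (hx.smul hβ).ne_zero
  set P := α • a
  set Q := β • x
  set R := γ • g
  have dP := S.dn (zkl.trans zjk) P
  have dR := S.dn (zjk.trans zij) R
  have hsum : (S.ev i P - S.ev l P) + (S.ev i Q - S.ev l Q) + (S.ev i R - S.ev l R)
      = (S.h P + S.h Q + S.h R) * (S.z i - S.z l) := by
    have e1 : S.L i P + S.L i Q + S.L i R = 0 := by rw [← map_add, ← map_add, h0, map_zero]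
    have e2 : S.L l P + S.L l Q + S.L l R = 0 := by rw [← map_add, ← map_add, h0, map_zero]
    simp only [ev]
    linear_combination e1 - e2
  have k1 := S.add_sub_le Q R
  have k2 := S.add_sub_le Q P
  have k3 := S.sub' P R
  rw [show Q + R = -P by rw [← sub_eq_zero, ← h0]; abel] at k1
  rw [show Q + P = -R by rw [← sub_eq_zero, ← h0]; abel] at k2
  rw [show P + R = -Q by rw [← sub_eq_zero, ← h0]; abel] at k3
  set s := S.h P + S.h Q + S.h R with hs
  have m1 : s ≤ S.wd P + S.wd Q := by simp only [wd] at k1 ⊢; linarith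
  have m2 : s ≤ S.wd R + S.wd Q := by simp only [wd] at k2 ⊢; linarith
  have m3 : 0 ≤ s - S.wd Q := by simp only [wd]; linarith
  -- The height ranges `j`–`l` and `i`–`k` cover `i`–`l` and overlap in `j`–`k`; `m3` pays for the
  -- overlap.
  have n1 := mul_le_mul_of_nonneg_right m1 (show 0 ≤ S.z j - S.z l by linarith)
  have n2 := mul_le_mul_of_nonneg_right m2 (show 0 ≤ S.z i - S.z k by linarith)
  have n3 := mul_nonneg m3 (show 0 ≤ S.z j - S.z k by linarith)
  have n4 := mul_pos wQ (show 0 < 1 - (S.z i - S.z l) by linarith)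
  linarith

/-- A direction in which two upper points are level at the top and two lower points are level
at the bottom forces a box. -/
theorem exists_box_of_conflict (hij : i ≠ j) (hkl : k ≠ l) (zij : S.z j ≤ S.z i)
    (zjk : S.z k ≤ S.z j) (zkl : S.z l ≤ S.z k) (h1 : S.z i - S.z l < 1) (hx : x ≠ 0)
    (eij : S.ev i x = S.ev j x) (ekl : S.ev k x = S.ev l x)
    (eik : S.ev i x - S.ev k x = S.wd x) :
    ∃ a, S.Box a x ∧ S.Act i j a ∧ (S.Act k l (-a) ∨ S.Act k l a) := by
  have xik : S.Act i k x := ⟨hx, eik⟩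
  have xil : S.Act i l x := ⟨hx, by linarith⟩
  have xjk : S.Act j k x := ⟨hx, by linarith⟩
  have xjl : S.Act j l x := ⟨hx, by linarith⟩
  have wx := S.wd_pos hx
  obtain ⟨a, ha⟩ := S.act hij zij (by linarith)
  obtain ⟨g, hg⟩ := S.act hkl zkl (by linarith)
  have hax : br 1 a x ≠ 0 := fun h0 => by
    obtain ⟨c, hc, hxa⟩ :=
      triple_parallel_left ha xik xjk zij zjk (by linarith) one_ne_zero h0
    have := (ha.smul hc).eq
    have := S.wd_pos (ha.smul hc).ne_zero
    rw [← hxa] at *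
    linarith
  have hxg : br 1 x g ≠ 0 := fun h0 => by
    obtain ⟨c, hc, hxa⟩ :=
      triple_parallel_right xjk xjl hg zjk zkl (by linarith) one_ne_zero h0
    have h2 := hg.eq
    have := S.wd_pos hg.ne_zero
    rw [hxa, S.ev_smul _ hc.le, S.ev_smul _ hc.le, ekl, ← hxa] at h2
    linarith
  obtain ⟨s, hs, hax'⟩ : ∃ s : ℝ, s ≠ 0 ∧ 0 < br s a x := by
    rcases lt_or_gt_of_ne hax with h | h
    · exact ⟨-1, by norm_num, by rw [br_neg_scale]; linarith⟩
    · exact ⟨1, by norm_num, h⟩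
  have hxg' : br s x g ≠ 0 := by
    simp only [br, one_mul] at hxg ⊢
    exact mul_ne_zero hs hxg
  have rel := br_relation s a x g
  -- Only parallel `a` and `g` survive. Otherwise the bracket relation puts one of `a`, `g`, `x` in
  -- the cone of the other two, against extremality, or balances all three.
  rcases lt_or_gt_of_ne hxg' with hxg' | hxg'
  · rw [br_swap] at hxg'
    rcases lt_trichotomy (br s a g) 0 with hag | hag | hag
    · exfalso
      have := xjl.lt_comb (w := br s g x • a) (v := g) (a := -br s a g) (b := br s a x) (by linarith)
        (by linarith) (hg.le_right j) (by linarith) hax'.le (by rw [rel]; module)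
      exact absurd this (not_lt.2 ((ha.smul (by linarith)).le_right l))
    · obtain ⟨c, hc, hga⟩ := exists_smul_of_br_eq_zero hs ha.ne_zero hg.ne_zero hag
      rw [hga, br_smul_left] at hxg'
      have hc : 0 < c := by
        by_contra! hc'
        nlinarith
      have ha' : S.Act k l a := by
        have := hg.smul (inv_pos.2 hc)
        rwa [hga, smul_smul, inv_mul_cancel₀ hc.ne', one_smul] at this
      have e1 := ha.eq
      have e2 := ha'.eq
      have l1 := ha.le_left k
      have l2 := ha.le_right l
      have l3 := ha'.le_left i
      have ail : S.Act i l a := ⟨ha.ne_zero, by linarith⟩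
      have ajk : S.Act j k (-a) := by
        refine ⟨neg_ne_zero.2 ha.ne_zero, le_antisymm (S.diff_le _ _ _) ?_⟩
        rw [S.ev_neg, S.ev_neg, S.wd_neg]
        nlinarith [S.wd_nonneg a]
      -- Two quadrants come from `i, l`, separated along `a` and `x`; the other two from `j, k`,
      -- separated along `-a` and `x`.
      refine ⟨a, ⟨hax, ail.h_add xil h1, ?_, ?_, ail.h_neg_add xil⟩, ha, Or.inr ha'⟩
      · simpa only [neg_neg] using ajk.h_neg_add xjk
      · exact ajk.h_add xjk (by linarith)
    · exfalso
      have := xik.lt_comb (w := br s a x • g) (v := a) (a := br s a g) (b := br s g x)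
        (by linarith) (by linarith) (ha.le_left k) hag (by linarith) (by rw [rel]; module)
      exact absurd this (not_lt.2 ((hg.smul hax').le_left i))
  · rcases lt_trichotomy (br s a g) 0 with hag | hag | hag
    · exfalso
      exact conflict_balance ha xil hg zij zjk zkl h1 hxg' (neg_pos.2 hag) hax'
        (by rw [br_swap s x g, neg_smul, rel]; module)
    · obtain ⟨c, hc, hga⟩ := exists_smul_of_br_eq_zero hs ha.ne_zero hg.ne_zero hag
      rw [hga, br_smul_right, br_swap] at hxg'
      have hc : 0 < -c := by
        by_contra! hc'
        nlinarith
      have ha' : S.Act k l (-a) := by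
        have := hg.smul (inv_pos.2 hc)
        rwa [hga, show c • a = -c • -a by module, smul_smul, inv_mul_cancel₀ hc.ne', one_smul]
          at this
      have e1 := ha.eq
      have e2 := ha'.eq
      have l1 := ha'.le_left j
      have l2 := ha.le_right k
      have hw := S.wd_nonneg a
      have l3 := l1
      rw [S.ev_neg, S.ev_neg] at l3
      have aik : S.Act i k a := ⟨ha.ne_zero, by nlinarith⟩
      have ajl : S.Act j l (-a) := by
        refine ⟨neg_ne_zero.2 ha.ne_zero, ?_⟩
        have : S.ev k (-a) ≤ S.ev j (-a) := by
          rw [S.ev_neg, S.ev_neg]; nlinarith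
        linarith
      refine ⟨a, ⟨hax, aik.h_add xik (by linarith), ?_, ?_, aik.h_neg_add xik⟩, ha, Or.inl ha'⟩
      · simpa only [neg_neg] using ajl.h_neg_add xjl
      · exact ajl.h_add xjl (by linarith)
    · exfalso
      have := S.le_comb (w := br s a g • x) (a := br s x g) (b := br s a x) zjk
        (ha.le_right k) (hg.le_left j) hxg'.le hax'.le
        (by rw [rel, br_swap s x g]; module)
      exact absurd this (not_le.2 (by linarith [(xjk.smul hag).eq, S.wd_pos (xjk.smul hag).ne_zero]))

/-- The conflict configuration leaves no room for a fifth point. -/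
theorem conflict (hij : i ≠ j) (hkl : k ≠ l) (zij : S.z j ≤ S.z i)
    (zjk : S.z k ≤ S.z j) (zkl : S.z l ≤ S.z k) (h1 : S.z i - S.z l < 1) (hx : x ≠ 0)
    (eij : S.ev i x = S.ev j x) (ekl : S.ev k x = S.ev l x)
    (eik : S.ev i x - S.ev k x = S.wd x)
    (hmi : m ≠ i) (hmj : m ≠ j) (hmk : m ≠ k) (hml : m ≠ l)
    (h2 : S.z i - S.z m < 1) (h3 : S.z m - S.z l < 1) : False := by
  obtain ⟨a, hB, ha, hg⟩ := exists_box_of_conflict hij hkl zij zjk zkl h1 hx eij ekl eik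
  have ha0 := ha.ne_zero
  have na := ha.nv_eq
  have xik := Act.nv_eq (S := S) ⟨hx, eik⟩
  have xil := Act.nv_eq (S := S) (i := i) (j := l) ⟨hx, by linarith⟩
  have xjk := Act.nv_eq (S := S) (i := j) (j := k) ⟨hx, by linarith⟩
  have ci := hB.cases' hmi (by linarith) (by linarith)
  have cj := hB.cases' hmj (by linarith) (by linarith)
  have ck := hB.cases' hmk (by linarith) (by linarith)
  have cl := hB.cases' hml (by linarith) (by linarith)
  rcases hg with hg | hg
  · have ng := hg.nv_eq
    rw [nv_neg k ha0, nv_neg l ha0] at ng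
    exact no_fifth_of_opposite_sides (A := fun p => S.nv p a) (X := fun p => S.nv p x) (z := S.z) zij zjk zkl h1 h2 h3
      (fun p q => nv_sub_le p q ha0) (fun p q => nv_sub_le p q hx) (fun p q => nv_sub_le_neg p q ha0)
      (fun p q => nv_sub_le_neg p q hx) na xik xil xjk ng ci cj ck cl
  · exact no_fifth_of_same_side (A := fun p => S.nv p a) (X := fun p => S.nv p x) (z := S.z) zij zjk zkl h1 h2 h3
      (fun p q => nv_sub_le p q ha0) (fun p q => nv_sub_le p q hx) (fun p q => nv_sub_le_neg p q ha0)
      (fun p q => nv_sub_le_neg p q hx) na xik xil xjk hg.nv_eq ci cj ck cl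

end conflict

end TouchSystem

namespace TouchSystem

variable {ι : Type*} {S : TouchSystem ι}

/-! ### Quadruples -/

variable (S) in
/-- Four points of decreasing height, with directions separating them pairwise. -/
structure Quad (i j k l : ι) (a b c d e g : ℝ × ℝ) : Prop where
  ha : S.Act i j a
  hb : S.Act i k b
  hc : S.Act i l c
  hd : S.Act j k d
  he : S.Act j l e
  hg : S.Act k l g
  zij : S.z j ≤ S.z i
  zjk : S.z k ≤ S.z j
  zkl : S.z l ≤ S.z k
  lt : S.z i - S.z l < 1

variable {s : ℝ} {t i j k l m n : ι} {a b c d e g y r : ℝ × ℝ}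

/-- Both `i` and `j` are maximal and both `k` and `l` minimal in the common direction: this is the
input of `conflict`. -/
theorem Act.conflict {x y : ℝ × ℝ} {c : ℝ} (h : S.Act i l x) (h' : S.Act j k y) (hc : 0 < c)
    (hy : y = c • x) : S.ev i x = S.ev j x ∧ S.ev k x = S.ev l x ∧
      S.ev i x - S.ev k x = S.wd x := by
  have h'' := h'.smul (inv_pos.2 hc)
  rw [hy, smul_smul, inv_mul_cancel₀ hc.ne', one_smul] at h''
  have := h.le_left j
  have := h.le_right k
  have := h''.le_left i
  have := h''.le_right l
  have := h.eq
  refine ⟨?_, ?_, ?_⟩ <;> linarith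

theorem Quad.false_of_crossing (Q : S.Quad i j k l a b c d e g) {x : ℝ × ℝ}
    (hmi : m ≠ i) (hmj : m ≠ j) (hmk : m ≠ k) (hml : m ≠ l) (h2 : S.z i - S.z m < 1)
    (h3 : S.z m - S.z l < 1)
    (h : S.ev i x = S.ev j x ∧ S.ev k x = S.ev l x ∧ S.ev i x - S.ev k x = S.wd x)
    (hx : x ≠ 0) : False :=
  conflict Q.ha.ne Q.hg.ne Q.zij Q.zjk Q.zkl Q.lt hx h.1 h.2.1 h.2.2 hmi hmj hmk hml h2 h3

/-- The position of `c` relative to `d` decides: `c`, topped by `i`, falls between `d` and `e`,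
topped by `j`; or `c`, with bottom `l`, falls between `b` and `d`, with bottom `k`; or `c` and `d`
are parallel and `conflict` applies. Degenerate brackets are treated apart. -/
theorem Quad.not_pppp (hs : s ≠ 0) (Q : S.Quad i j k l a b c d e g)
    (hmi : m ≠ i) (hmj : m ≠ j) (hmk : m ≠ k) (hml : m ≠ l) (h2 : S.z i - S.z m < 1)
    (h3 : S.z m - S.z l < 1) (h123 : Pos s a b d) (h124 : Pos s a c e)
    (h134 : Pos s b c g) (h234 : Pos s d e g) : False := by
  have zij := Q.zij
  have zjk := Q.zjk
  have zkl := Q.zkl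
  have hlt := Q.lt
  obtain ⟨ab, bd, ad, abd⟩ := h123
  obtain ⟨ac, ce, ae, ace⟩ := h124
  obtain ⟨bc, cg, bg, bcg⟩ := h134
  obtain ⟨de, eg, dg, deg⟩ := h234
  rcases lt_trichotomy (br s c d) 0 with h | h | h
  · have h' : 0 < br s d c := by rw [br_swap]; linarith
    rcases ce.eq_or_lt with ce0 | ce0
    · have := Q.ha.lt_comb (w := br s a c • d) (v := c) (a := br s d c) (b := br s a d) zij
        (by linarith) (Q.hc.le_left j) h' ad (br_relation _ _ _ _)
      exact absurd this (not_lt.2 ((Q.hd.smul (by linarith)).le_left i))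
    rcases de.eq_or_lt with de0 | de0
    · obtain ⟨x, hx, rfl⟩ := triple_parallel_left Q.hd Q.he Q.hg zjk zkl (by linarith) hs de0.symm
      rw [br_smul_right] at ce0
      nlinarith
    · exact not_between_left Q.hd Q.he Q.hc Q.ha.ne zij (by linarith) h' ce0 de0
  · obtain ⟨x, hx, hcd⟩ := exists_smul_of_br_eq_zero hs Q.hc.ne_zero Q.hd.ne_zero h
    rcases lt_or_gt_of_ne hx with hx | hx
    · rw [hcd, br_smul_right] at ad
      rw [hcd, br_smul_left] at de
      nlinarith
    · exact Q.false_of_crossing hmi hmj hmk hml h2 h3 (Q.hc.conflict Q.hd hx hcd) Q.hc.ne_zero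
  · rcases bc.eq_or_lt with bc0 | bc0
    · have := Q.hg.lt_comb (w := br s c g • d) (v := c) (a := br s c d) (b := br s d g) zkl
        (by linarith) (Q.hc.le_right k) h dg (by rw [br_relation]; abel)
      exact absurd this (not_lt.2 ((Q.hd.smul (by linarith)).le_right l))
    rcases bd.eq_or_lt with bd0 | bd0
    · obtain ⟨x, hx, rfl⟩ := triple_parallel_right Q.ha Q.hb Q.hd zij zjk (by linarith) hs bd0.symm
      rw [br_smul_right, br_swap] at h
      nlinarith
    · exact not_between_right Q.hb Q.hd Q.hc Q.hg.ne.symm zkl (by linarith) bc0 h bd0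

/-- The argument of `Quad.not_pppp` with `b` and `e` in place of `c` and `d`: `b` falls between `e`
and `d`, or `e` between `b` and `d`, or they are parallel. -/
theorem Quad.not_ppmm (hs : s ≠ 0) (Q : S.Quad i j k l a b c d e g)
    (hmi : m ≠ i) (hmj : m ≠ j) (hmk : m ≠ k) (hml : m ≠ l) (h2 : S.z i - S.z m < 1)
    (h3 : S.z m - S.z l < 1) (h123 : Pos s a b d) (h124 : Pos s a c e)
    (h134 : Pos (-s) b c g) (h234 : Pos (-s) d e g) : False := by
  have zij := Q.zij
  have zjk := Q.zjk
  have zkl := Q.zkl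
  have hlt := Q.lt
  obtain ⟨ab, bd, ad, abd⟩ := h123
  obtain ⟨ac, ce, ae, ace⟩ := h124
  obtain ⟨bc, cg, bg, bcg⟩ := h134.neg
  obtain ⟨de, eg, dg, deg⟩ := h234.neg
  rw [br_swap] at bc cg bg de eg dg
  rw [br_swap s b c, br_swap s c g] at bcg
  rw [br_swap s d e, br_swap s e g] at deg
  rcases lt_trichotomy (br s b e) 0 with h | h | h
  · have h' : 0 < br s e b := by rw [br_swap]; linarith
    rcases bd.eq_or_lt with bd0 | bd0
    · have := Q.ha.lt_comb (w := br s a b • e) (v := b) (a := br s e b) (b := br s a e) zij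
        (by linarith) (Q.hb.le_left j) h' ae (br_relation _ _ _ _)
      exact absurd this (not_lt.2 ((Q.he.smul (by linarith)).le_left i))
    rcases (neg_nonpos.1 de).eq_or_lt with de0 | de0
    · obtain ⟨x, hx, rfl⟩ := triple_parallel_left Q.hd Q.he Q.hg zjk zkl (by linarith) hs
        (by rw [br_swap]; linarith)
      rw [br_smul_right] at h
      nlinarith
    · exact not_between_left Q.he Q.hd Q.hb Q.ha.ne zij (by linarith) h' bd0 de0
  · obtain ⟨x, hx, hbe⟩ := exists_smul_of_br_eq_zero hs Q.hb.ne_zero Q.he.ne_zero h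
    rcases lt_or_gt_of_ne hx with hx | hx
    · rw [hbe, br_smul_right] at ae
      rw [hbe, br_smul_left] at de
      nlinarith
    · have := Q.hb.conflict Q.he hx hbe
      exact Q.false_of_crossing hmi hmj hmk hml h2 h3 ⟨this.1, this.2.1.symm, by linarith [this.2]⟩
        Q.hb.ne_zero
  · rcases (neg_nonpos.1 de).eq_or_lt with de0 | de0
    · have := Q.hg.lt_comb (w := br s g e • b) (v := e) (a := br s b e) (b := br s g b) zkl
        (by linarith) (Q.he.le_right k) h (by linarith) (br_relation _ _ _ _)
      exact absurd this (not_lt.2 ((Q.hb.smul (by linarith)).le_right l))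
    rcases bd.eq_or_lt with bd0 | bd0
    · obtain ⟨x, hx, rfl⟩ := triple_parallel_right Q.ha Q.hb Q.hd zij zjk (by linarith) hs bd0.symm
      rw [br_smul_right, br_swap] at de0
      nlinarith
    · exact not_between_right Q.hb Q.hd Q.he Q.hg.ne.symm zkl (by linarith) h de0 bd0

/-- The directions `a`, `b`, `c` balance, and `i` is maximal in each. A point `t` at least as high
must then coincide with `i` in height and position, so nothing can separate the two. -/
theorem Quad.not_pmpp (hs : s ≠ 0) (Q : S.Quad i j k l a b c d e g)
    (hti : t ≠ i) (hz : S.z i ≤ S.z t) (h123 : Pos s a b d) (h124 : Pos (-s) a c e)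
    (h134 : Pos s b c g) (h234 : Pos s d e g) : False := by
  have zij := Q.zij
  have zjk := Q.zjk
  have zkl := Q.zkl
  have hlt := Q.lt
  obtain ⟨ab, bd, ad, abd⟩ := h123
  obtain ⟨ac, ce, ae, ace⟩ := h124.neg
  obtain ⟨bc, cg, bg, bcg⟩ := h134
  obtain ⟨de, eg, dg, deg⟩ := h234
  have hpl := br_plucker s a d e g
  rcases ab.eq_or_lt with ab0 | ab0
  · obtain ⟨x, hx, rfl⟩ := triple_parallel_left Q.ha Q.hb Q.hd zij zjk (by linarith) hs ab0.symm
    simp only [br_smul_left] at bc bd abd bcg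
    have ac0 : br s a c = 0 := by nlinarith
    obtain ⟨x', hx', rfl⟩ := triple_parallel_left Q.ha Q.hc Q.he (zij) (zkl.trans zjk) (by linarith)
      hs ac0
    simp only [br_smul_left, br_smul_right, br_self, mul_zero, zero_add] at *
    have had : 0 < br s a d := by nlinarith
    have hae : br s a e < 0 := by nlinarith
    have hag : 0 < br s a g := by nlinarith
    -- When `a`, `b`, `c` are parallel, the Plücker relation has only nonnegative terms, not all
    -- zero.
    nlinarith [mul_nonneg had.le eg, mul_nonneg (neg_nonneg.2 hae.le) dg, mul_nonneg hag.le de,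
      mul_pos had deg, mul_pos hag deg]
  have ac0 : br s a c < 0 := by
    refine ac.lt_of_ne fun h0 => ?_
    obtain ⟨x, hx, rfl⟩ := triple_parallel_left Q.ha Q.hc Q.he zij (zkl.trans zjk) (by linarith)
      hs h0
    rw [br_smul_right, br_swap] at bc
    nlinarith
  have bc0 : 0 < br s b c := by
    refine bc.lt_of_ne fun h0 => ?_
    obtain ⟨x, hx, rfl⟩ := triple_parallel_left Q.hb Q.hc Q.hg (zjk.trans zij) zkl (by linarith)
      hs h0.symm
    rw [br_smul_right] at ac0
    nlinarith
  have rel : br s b c • a + (-br s a c) • b + br s a b • c = 0 := by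
    rw [br_relation s a b c, br_swap s c b]; module
  have ea := (Q.ha.smul bc0).le_left t
  have eb := (Q.hb.smul (neg_pos.2 ac0)).le_left t
  have ec := (Q.hc.smul ab0).le_left t
  have hP := (Q.ha.smul bc0).ne_zero
  have hQ := (Q.hb.smul (neg_pos.2 ac0)).ne_zero
  have hPQ : br s (br s b c • a) ((-br s a c) • b) ≠ 0 := by
    rw [br_smul_left, br_smul_right]
    have := mul_pos bc0 (mul_pos (neg_pos.2 ac0) ab0)
    exact this.ne'
  set P := br s b c • a
  set R := (-br s a c) • b
  set T := br s a b • c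
  have hsum : (S.ev i P - S.ev t P) + (S.ev i R - S.ev t R) + (S.ev i T - S.ev t T)
      = (S.h P + S.h R + S.h T) * (S.z i - S.z t) := by
    have e1 : S.L i P + S.L i R + S.L i T = 0 := by rw [← map_add, ← map_add, rel, map_zero]
    have e2 : S.L t P + S.L t R + S.L t T = 0 := by rw [← map_add, ← map_add, rel, map_zero]
    simp only [ev]
    linear_combination e1 - e2
  have hpos : 0 < S.h P + S.h R + S.h T := by
    have h1 := S.sub' R T
    have h2 := S.wd_pos hP
    rw [show R + T = -P by rw [← sub_eq_zero, ← rel]; abel] at h1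
    simp only [wd] at h2
    linarith
  have hzz : S.z i = S.z t := by nlinarith
  rw [hzz, sub_self, mul_zero] at hsum
  have eP : S.ev i P = S.ev t P := by linarith
  have eR : S.ev i R = S.ev t R := by linarith
  simp only [ev, hzz] at eP eR
  obtain ⟨y, hy⟩ := S.act hti hz (by linarith)
  have h1 := hy.eq
  have h2 := S.wd_pos hy.ne_zero
  obtain ⟨α, β, rfl⟩ : ∃ α β : ℝ, y = α • P + β • R := ⟨_, _, br_decomp hPQ y⟩
  simp only [ev, hzz, map_add, map_smul, smul_eq_mul] at h1
  have e1 : S.L i P = S.L t P := by linarith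
  have e2 : S.L i R = S.L t R := by linarith
  rw [e1, e2] at h1
  linarith

/-- Generically `a`, topped by `i`, lies strictly between `e` and `d`, topped by the lower `j`. In
the degenerate case `d` and `e` are negative multiples of `a`, and the Plücker relation has terms of
one sign. -/
theorem Quad.not_pmmm (hs : s ≠ 0) (Q : S.Quad i j k l a b c d e g)
    (h123 : Pos s a b d) (h124 : Pos (-s) a c e)
    (h134 : Pos (-s) b c g) (h234 : Pos (-s) d e g) : False := by
  have zij := Q.zij
  have zjk := Q.zjk
  have zkl := Q.zkl
  have hlt := Q.lt
  obtain ⟨ab, bd, ad, abd⟩ := h123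
  obtain ⟨ac, ce, ae, ace⟩ := h124.neg
  obtain ⟨bc, cg, bg, bcg⟩ := h134.neg
  obtain ⟨de, eg, dg, deg⟩ := h234.neg
  have key : ∀ {x : ℝ × ℝ} {c : ℝ} {p : ι}, c ≠ 0 → S.Act j p x → x = c • a → c < 0 := by
    intro x c p hc hx hxa
    by_contra! hc'
    have h3 := Q.ha.smul (hc'.lt_of_ne hc.symm)
    have h4 := hx.le_left i
    rw [← hxa] at h3
    linarith [h3.eq, S.wd_pos h3.ne_zero]
  have all0 : br s a d = 0 ∧ br s a e = 0 ∧ br s d e = 0 := by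
    rcases ad.eq_or_lt with ad0 | ad0
    · obtain ⟨x, hx, hda⟩ := exists_smul_of_br_eq_zero hs Q.ha.ne_zero Q.hd.ne_zero ad0.symm
      have hx := key hx Q.hd hda
      rw [hda, br_smul_left] at de
      have : br s a e = 0 := by nlinarith
      exact ⟨ad0.symm, this, by rw [hda, br_smul_left, this, mul_zero]⟩
    rcases ae.eq_or_lt with ae0 | ae0
    · obtain ⟨x, hx, hea⟩ := exists_smul_of_br_eq_zero hs Q.ha.ne_zero Q.he.ne_zero ae0
      have hx := key hx Q.he hea
      rw [hea, br_smul_right, br_swap] at de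
      nlinarith
    rcases de.eq_or_lt with de0 | de0
    · obtain ⟨x, hx, hed⟩ := triple_parallel_left Q.hd Q.he Q.hg zjk zkl (by linarith) hs de0
      rw [hed, br_smul_right] at ae0
      nlinarith
    · exact (not_between_left (s := s) Q.he Q.hd Q.ha Q.ha.ne zij (by linarith)
        (by rw [br_swap]; linarith) ad0 (by rw [br_swap]; linarith)).elim
  obtain ⟨ad0, ae0, de0⟩ := all0
  obtain ⟨x, hx, hda⟩ := exists_smul_of_br_eq_zero hs Q.ha.ne_zero Q.hd.ne_zero ad0
  obtain ⟨x', hx', hea⟩ := exists_smul_of_br_eq_zero hs Q.ha.ne_zero Q.he.ne_zero ae0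
  have hx := key hx Q.hd hda
  have hx' := key hx' Q.he hea
  have e1 : br s b d = -x * br s a b := by rw [hda, br_smul_right, br_swap]; ring
  have e2 : br s c e = -x' * br s a c := by rw [hea, br_smul_right, br_swap]; ring
  have e3 : br s e g = x' * br s a g := by rw [hea, br_smul_left]
  rw [e1] at abd
  rw [e2] at ace
  rw [de0, e3] at deg
  have hab : 0 < br s a b := by nlinarith
  have hac : br s a c < 0 := by nlinarith
  have hag : 0 < br s a g := by nlinarith
  have hpl := br_plucker s a b c g
  nlinarith [mul_nonneg hab.le (neg_nonneg.2 cg), mul_nonneg (neg_nonneg.2 hac.le) (neg_nonneg.2 bg),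
    mul_nonneg hag.le (neg_nonneg.2 bc), mul_pos hab (neg_pos.2 bcg), mul_pos hag (neg_pos.2 bcg)]

/-! ### A quadruple and a lower point -/

/-- The orientation of `j, k, l` dictates the side of `g` on which `y` may lie. On the wrong side,
`e` falls between `y` and `g` (both topped by `k`), or `y` between `e` and `g` (both with bottom
`l`), or `e` and `y` are parallel and `conflict` applies. -/
theorem lower_not_pos (hs : s ≠ 0) (hd : S.Act j k d) (he : S.Act j l e) (hg : S.Act k l g)
    (hy : S.Act k n y) (zjk : S.z k ≤ S.z j) (zkl : S.z l ≤ S.z k) (zln : S.z n ≤ S.z l)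
    (hlt : S.z j - S.z n < 1) (hln : l ≠ n) (hmj : m ≠ j) (hmk : m ≠ k) (hml : m ≠ l) (hmn : m ≠ n)
    (h2 : S.z j - S.z m < 1) (h3 : S.z m - S.z n < 1) (h234 : Pos s d e g)
    (hyg : 0 < br s y g) : False := by
  obtain ⟨de, eg, dg, deg⟩ := h234
  rcases eg.eq_or_lt with eg0 | eg0
  · obtain ⟨x, hx, hge⟩ := triple_parallel_right hd he hg zjk zkl (by linarith) hs eg0.symm
    have hye : 0 < br s y e := by
      rw [hge, br_smul_right] at hyg
      exact pos_of_mul_pos_right hyg hx.le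
    have hdg : 0 < br s d g := by
      rw [hge, br_smul_right]
      exact mul_pos hx (by linarith)
    rcases le_or_gt 0 (br s d y) with h | h
    · have := hd.lt_comb (w := br s d e • y) (v := e) (a := br s y e) (b := br s d y) zjk
        (by linarith) (he.le_left k) hye h (br_relation _ _ _ _)
      exact absurd this (not_lt.2 ((hy.smul (by linarith)).le_left j))
    · exact not_between_left (s := s) hy hg hd hd.ne zjk (by linarith) (by rw [br_swap]; linarith)
        hdg hyg
  · rcases lt_trichotomy (br s e y) 0 with h | h | h
    · exact not_between_left (s := s) hy hg he hd.ne zjk (by linarith) (by rw [br_swap]; linarith)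
        eg0 hyg
    · obtain ⟨x, hx, hye⟩ := exists_smul_of_br_eq_zero hs he.ne_zero hy.ne_zero h
      rw [hye, br_smul_left] at hyg
      have hx : 0 < x := pos_of_mul_pos_left hyg eg
      have := he.conflict hy hx hye
      exact conflict hd.ne hln zjk zkl zln hlt he.ne_zero this.1 this.2.1.symm (by linarith [this.2])
        hmj hmk hml hmn h2 h3
    · exact not_between_right he hg hy hln.symm zln (by linarith) h hyg eg0

theorem lower_not_parallel (hs : s ≠ 0) (hd : S.Act j k d) (he : S.Act j l e) (hg : S.Act k l g)
    (hy : S.Act k n y) (hr : S.Act l n r)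
    (zjk : S.z k ≤ S.z j) (zkl : S.z l ≤ S.z k) (zln : S.z n ≤ S.z l)
    (hlt : S.z j - S.z n < 1) (hmj : m ≠ j) (hmk : m ≠ k) (hml : m ≠ l) (hmn : m ≠ n)
    (h2 : S.z j - S.z m < 1) (h3 : S.z m - S.z n < 1) (h234 : Pos s d e g)
    {x : ℝ} (hx : 0 < x) (hyg : y = x • g) (hrg : 0 < br s r g) : False := by
  obtain ⟨de, eg, dg, deg⟩ := h234
  rcases eg.eq_or_lt with eg0 | eg0
  · obtain ⟨x', hx', hge⟩ := triple_parallel_right hd he hg zjk zkl (by linarith) hs eg0.symm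
    have := he.conflict hy (mul_pos hx hx') (by rw [hyg, hge, smul_smul])
    exact conflict hd.ne hr.ne zjk zkl zln hlt he.ne_zero this.1 this.2.1.symm (by linarith [this.2])
      hmj hmk hml hmn h2 h3
  · rcases le_or_gt 0 (br s r e) with h | h
    · have hgn : S.ev n g ≤ S.ev l g := by
        have := hy.le_right l
        rw [hyg, S.ev_smul _ hx.le, S.ev_smul _ hx.le] at this
        exact le_of_mul_le_mul_left this hx
      have := hr.lt_comb (w := br s r g • e) (v := g) (a := br s e g) (b := br s r e) zln
        (by linarith) hgn eg0 h (br_relation _ _ _ _)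
      exact absurd this (not_lt.2 ((he.smul hrg).le_right n))
    · exact not_between_right (s := s) he hg hr hr.ne.symm zln (by linarith)
        (by rw [br_swap]; linarith) hrg eg0

/-- The triples `i, k, l` and `j, k, l` forbid opposite sides of `g` to the direction `y` separating
`k` from the lower point `n`. If `y` is parallel to `g`, the direction `r` separating `l` from `n`
plays its role. -/
theorem Quad.not_opposite (hs : s ≠ 0) (Q : S.Quad i j k l a b c d e g) (hin : i ≠ n) (hjn : j ≠ n)
    (hkn : k ≠ n) (hln : l ≠ n) (zln : S.z n ≤ S.z l)
    (hlt : S.z i - S.z n < 1) (h134 : Pos s b c g) (h234 : Pos (-s) d e g) : False := by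
  have zij := Q.zij
  have zjk := Q.zjk
  have zkl := Q.zkl
  obtain ⟨y, hy⟩ := S.act hkn (zln.trans zkl) (by linarith)
  obtain ⟨r, hr⟩ := S.act hln zln (by linarith)
  have hs' := neg_ne_zero.2 hs
  rcases lt_trichotomy (br s g y) 0 with h | h | h
  · exact lower_not_pos hs Q.hb Q.hc Q.hg hy (zjk.trans zij) zkl zln hlt hln Q.ha.ne.symm Q.hd.ne
      Q.he.ne hjn (by linarith) (by linarith) h134 (by rw [br_swap]; linarith)
  · obtain ⟨x, hx, hyg⟩ := triple_parallel_left Q.hg hy hr zkl zln (by linarith) hs h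
    rcases lt_trichotomy (br s g r) 0 with h' | h' | h'
    · exact lower_not_parallel hs Q.hb Q.hc Q.hg hy hr (zjk.trans zij) zkl zln hlt Q.ha.ne.symm
        Q.hd.ne Q.he.ne hjn (by linarith) (by linarith) h134 hx hyg (by rw [br_swap]; linarith)
    · have hyr : br s y r = 0 := by rw [hyg, br_smul_left, h', mul_zero]
      rcases triple_pos Q.hg hy hr zkl zln (by linarith) hs with h0 | h0
      · linarith [h0.2.2.2]
      · linarith [h0.neg.2.2.2]
    · exact lower_not_parallel hs' Q.hd Q.he Q.hg hy hr zjk zkl zln (by linarith) Q.ha.ne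
        Q.hb.ne Q.hc.ne hin (by linarith) (by linarith) h234 hx hyg
        (by rw [br_neg_scale, br_swap]; linarith)
  · exact lower_not_pos hs' Q.hd Q.he Q.hg hy zjk zkl zln (by linarith) hln Q.ha.ne Q.hb.ne
      Q.hc.ne hin (by linarith) (by linarith) h234 (by rw [br_neg_scale, br_swap]; linarith)

/-- Six points cannot exist if all but the highest one lie within height less than one. -/
theorem false_of_range_lt (hti : t ≠ i) (hij : i ≠ j) (hik : i ≠ k) (hil : i ≠ l) (hin : i ≠ n)
    (hjk : j ≠ k) (hjl : j ≠ l) (hjn : j ≠ n) (hkl : k ≠ l) (hkn : k ≠ n) (hln : l ≠ n)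
    (zti : S.z i ≤ S.z t) (zij : S.z j ≤ S.z i) (zjk : S.z k ≤ S.z j) (zkl : S.z l ≤ S.z k)
    (zln : S.z n ≤ S.z l) (hlt : S.z i - S.z n < 1) : False := by
  obtain ⟨a, ha⟩ := S.act hij zij (by linarith)
  obtain ⟨b, hb⟩ := S.act hik (zjk.trans zij) (by linarith)
  obtain ⟨c, hc⟩ := S.act hil (by linarith) (by linarith)
  obtain ⟨d, hd⟩ := S.act hjk zjk (by linarith)
  obtain ⟨e, he⟩ := S.act hjl (by linarith) (by linarith)
  obtain ⟨g, hg⟩ := S.act hkl zkl (by linarith)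
  have Q : S.Quad i j k l a b c d e g := ⟨ha, hb, hc, hd, he, hg, zij, zjk, zkl, by linarith⟩
  have p123 := triple_pos (s := 1) ha hb hd zij zjk (by linarith) one_ne_zero
  obtain ⟨s, hs, h123⟩ : ∃ s : ℝ, s ≠ 0 ∧ Pos s a b d := by
    rcases p123 with h | h
    exacts [⟨1, one_ne_zero, h⟩, ⟨-1, by norm_num, h⟩]
  have hs' := neg_ne_zero.2 hs
  rcases triple_pos hb hc hg (zjk.trans zij) zkl (by linarith) hs with h134 | h134 <;>
    rcases triple_pos hd he hg zjk zkl (by linarith) hs with h234 | h234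
  · rcases triple_pos ha hc he zij (zkl.trans zjk) (by linarith) hs with h124 | h124
    · exact Q.not_pppp hs hin.symm hjn.symm hkn.symm hln.symm hlt (by linarith) h123 h124 h134 h234
    · exact Q.not_pmpp hs hti zti h123 h124 h134 h234
  · exact Q.not_opposite hs hin hjn hkn hln zln hlt h134 h234
  · exact Q.not_opposite hs' hin hjn hkn hln zln hlt h134 (by rwa [neg_neg])
  · rcases triple_pos ha hc he zij (zkl.trans zjk) (by linarith) hs with h124 | h124
    · exact Q.not_ppmm hs hin.symm hjn.symm hkn.symm hln.symm hlt (by linarith) h123 h124 h134 h234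
    · exact Q.not_pmmm hs h123 h124 h134 h234

end TouchSystem

/-! ### ### The maximal height range and the count of six -/

namespace TouchSystem

variable {ι : Type*} {S : TouchSystem ι}

theorem ev_le_of_height_eq_one {i j : ι} (h : S.z i - S.z j = 1) (u : ℝ × ℝ) :
    S.ev j u ≤ S.ev i u := by
  have := S.dn (i := i) (j := j) (by linarith) u
  rw [h, sub_self, zero_mul] at this
  linarith

/-- Two points at the top and two at the bottom of the maximal height range admit no
fifth point. -/
theorem false_of_two_top_two_bottom {p q e r w : ι} (hpq : p ≠ q) (hrw : r ≠ w) (hep : e ≠ p)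
    (heq : e ≠ q) (her : e ≠ r) (hew : e ≠ w) (zpq : S.z p = S.z q) (zrw : S.z r = S.z w)
    (zpr : S.z p - S.z r = 1) (zep : S.z e ≤ S.z p) (zre : S.z r ≤ S.z e) : False := by
  obtain ⟨u, hu⟩ := S.act hpq zpq.ge (by linarith)
  obtain ⟨v, hv⟩ := S.act hrw zrw.ge (by linarith)
  have eu := hu.eq
  have ev := hv.eq
  have hu0 := hu.ne_zero
  have hv0 := hv.ne_zero
  -- Across a height gap of exactly 1 the bottom points never exceed the top ones, so in direction
  -- `u` they are level with the minimal point `q`.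
  have ur : S.ev r u = S.ev q u :=
    le_antisymm (ev_le_of_height_eq_one (by linarith) u) (hu.le_right r)
  have uw : S.ev w u = S.ev q u :=
    le_antisymm (ev_le_of_height_eq_one (by linarith) u) (hu.le_right w)
  have vp : S.ev p v = S.ev r v :=
    le_antisymm (hv.le_left p) (ev_le_of_height_eq_one (by linarith) v)
  have vq : S.ev q v = S.ev r v :=
    le_antisymm (hv.le_left q) (ev_le_of_height_eq_one (by linarith) v)
  have upr : S.Act p r u := ⟨hu0, by linarith⟩
  have upw : S.Act p w u := ⟨hu0, by linarith⟩
  have vpw : S.Act p w v := ⟨hv0, by linarith⟩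
  have vqw : S.Act q w v := ⟨hv0, by linarith⟩
  have neg_act : ∀ {i j : ι} {x : ℝ × ℝ}, x ≠ 0 → S.z i - S.z j = 1 → S.ev i x = S.ev j x →
      S.Act i j (-x) := by
    intro i j x hx hz he
    refine ⟨neg_ne_zero.2 hx, ?_⟩
    rw [S.ev_neg, S.ev_neg, S.wd_neg, he]
    linear_combination S.wd x * hz
  have uqr : S.Act q r (-u) := neg_act hu0 (by linarith) (by linarith)
  have uqw : S.Act q w (-u) := neg_act hu0 (by linarith) (by linarith)
  have vpr : S.Act p r (-v) := neg_act hv0 (by linarith) (by linarith)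
  have vqr : S.Act q r (-v) := neg_act hv0 (by linarith) (by linarith)
  have hne : br 1 u v ≠ 0 := fun h0 => by
    obtain ⟨l, hl, rfl⟩ := exists_smul_of_br_eq_zero one_ne_zero hu0 hv0 h0
    have hpos := S.wd_pos hv0
    rcases lt_or_gt_of_ne hl with hl | hl
    · rw [show l • u = (-l) • -u by module, S.ev_smul _ (by linarith), S.ev_smul _ (by linarith),
        S.ev_neg, S.ev_neg, ur, uw, zrw] at ev
      rw [show l • u = (-l) • -u by module] at hpos
      linarith
    · rw [S.ev_smul _ hl.le, S.ev_smul _ hl.le, ur, uw] at ev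
      linarith
  have hB : S.Box u v := by
    refine ⟨hne, ?_, ?_, ?_, upw.h_neg_add vpw⟩
    · simpa only [neg_neg] using uqr.h_neg_add vqr
    · simpa only [neg_neg] using uqw.h_neg_add vqw
    · simpa only [neg_neg] using upr.h_neg_add vpr
  have c1 := hu.nv_eq
  have c2 := upr.nv_eq
  have c3 := upw.nv_eq
  have c4 := hv.nv_eq
  have c5 := vpw.nv_eq
  have c6 := vqw.nv_eq
  have b1 := nv_sub_le (S := S) p e hu0
  have b2 := nv_sub_le (S := S) e q hu0
  have b3 := nv_sub_le_neg (S := S) q e hu0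
  have b3' := nv_sub_le_neg (S := S) e r hu0
  have b4 := nv_sub_le_neg (S := S) e p hu0
  have b5 := nv_sub_le_neg (S := S) p e hv0
  have b6 := nv_sub_le (S := S) e w hv0
  have b7 := nv_sub_le (S := S) r e hv0
  have b8 := nv_sub_le_neg (S := S) e r hv0
  have b9 := nv_sub_le_neg (S := S) e w hv0
  -- The point `e` is compared with whichever pair is at height distance below 1, so that the box
  -- normals must separate it from both members.
  rcases zre.eq_or_lt with h0 | h0
  · have d1 := hB.cases her zre (by linarith)
    have d2 := hB.cases hew (by linarith) (by linarith)
    rcases d1 with d1 | d1 | d1 | d1 <;> try linarith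
    all_goals rcases d2 with d2 | d2 | d2 | d2 <;> linarith
  · have d1 := hB.cases hep.symm zep (by linarith)
    have d2 := hB.cases heq.symm (by linarith) (by linarith)
    rcases d1 with d1 | d1 | d1 | d1 <;> try linarith
    all_goals rcases d2 with d2 | d2 | d2 | d2 <;> linarith

/-- If neither the five lowest nor the five highest points span a height below 1, the bound 1 on all
height differences puts two points at the very top and two at the very bottom. -/
theorem false_of_six (S : TouchSystem ι) (f : Fin 6 → ι) (hf : Function.Injective f)
    (hz : Antitone (S.z ∘ f)) : False := by
  have ne : ∀ a b : Fin 6, a ≠ b → f a ≠ f b := fun a b h h' => h (hf h')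
  have le : ∀ a b : Fin 6, a ≤ b → S.z (f b) ≤ S.z (f a) := fun a b h => hz h
  by_cases h1 : S.z (f 1) - S.z (f 5) < 1
  · refine S.false_of_range_lt (t := f 0) (i := f 1) (j := f 2) (k := f 3) (l := f 4) (n := f 5)
      ?_ ?_ ?_ ?_ ?_ ?_ ?_ ?_ ?_ ?_ ?_ ?_ ?_ ?_ ?_ ?_ h1
    all_goals first | exact ne _ _ (by decide) | exact le _ _ (by decide)
  by_cases h2 : S.z (f 0) - S.z (f 4) < 1
  · refine S.dual.false_of_range_lt (t := f 5) (i := f 4) (j := f 3) (k := f 2) (l := f 1)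
      (n := f 0) ?_ ?_ ?_ ?_ ?_ ?_ ?_ ?_ ?_ ?_ ?_ ?_ ?_ ?_ ?_ ?_ ?_
    all_goals first
      | exact ne _ _ (by decide)
      | exact neg_le_neg (le _ _ (by decide))
      | (simp only [dual_z]; linarith)
  have l1 := S.le1 (f 0) (f 5)
  have l2 := le 0 1 (by decide)
  have l3 := le 4 5 (by decide)
  exact false_of_two_top_two_bottom (S := S) (p := f 0) (q := f 1) (e := f 2) (r := f 4) (w := f 5)
    (ne _ _ (by decide)) (ne _ _ (by decide)) (ne _ _ (by decide)) (ne _ _ (by decide))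
    (ne _ _ (by decide)) (ne _ _ (by decide)) (by linarith) (by linarith) (by linarith)
    (le _ _ (by decide)) (le _ _ (by decide))

end TouchSystem

/-! ### From touching cones to touching systems -/

section cone

open scoped Pointwise

variable {D : Set (EuclideanSpace ℝ (Fin 2))}

/-- The linear functional on the plane with coefficients `u`. -/
def planeForm (u : ℝ × ℝ) (p : EuclideanSpace ℝ (Fin 2)) : ℝ := u.1 * p 0 + u.2 * p 1

/-- The support function of `D`. -/
noncomputable def supportFn (D : Set (EuclideanSpace ℝ (Fin 2))) (u : ℝ × ℝ) : ℝ :=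
  sSup (planeForm u '' D)

theorem planeForm_add (u : ℝ × ℝ) (p q : EuclideanSpace ℝ (Fin 2)) :
    planeForm u (p + q) = planeForm u p + planeForm u q := by
  simp only [planeForm, PiLp.add_apply]; ring

theorem planeForm_smul (u : ℝ × ℝ) (c : ℝ) (p : EuclideanSpace ℝ (Fin 2)) :
    planeForm u (c • p) = c * planeForm u p := by
  simp only [planeForm, PiLp.smul_apply, smul_eq_mul]; ring

theorem planeForm_neg (u : ℝ × ℝ) (p : EuclideanSpace ℝ (Fin 2)) :
    planeForm (-u) p = -planeForm u p := by
  simp only [planeForm, Prod.fst_neg, Prod.snd_neg]; ring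

theorem continuous_planeForm (u : ℝ × ℝ) : Continuous (planeForm u) := by
  unfold planeForm; fun_prop

theorem IsConvexBody.nonempty (hD : IsConvexBody D) : D.Nonempty :=
  hD.nonempty_interior.mono interior_subset

theorem IsConvexBody.planeForm_le (hD : IsConvexBody D) (u : ℝ × ℝ)
    {d : EuclideanSpace ℝ (Fin 2)} (hd : d ∈ D) : planeForm u d ≤ supportFn D u :=
  le_csSup (hD.isCompact.image (continuous_planeForm u)).bddAbove (Set.mem_image_of_mem _ hd)

theorem IsConvexBody.supportFn_le (hD : IsConvexBody D) {u : ℝ × ℝ} {c : ℝ}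
    (h : ∀ d ∈ D, planeForm u d ≤ c) : supportFn D u ≤ c :=
  csSup_le (hD.nonempty.image _) (by rintro _ ⟨d, hd, rfl⟩; exact h d hd)

theorem IsConvexBody.supportFn_add_le (hD : IsConvexBody D) (u v : ℝ × ℝ) :
    supportFn D (u + v) ≤ supportFn D u + supportFn D v :=
  hD.supportFn_le fun d hd => by
    have h1 := hD.planeForm_le u hd
    have h2 := hD.planeForm_le v hd
    simp only [planeForm, Prod.fst_add, Prod.snd_add] at *
    linarith

theorem supportFn_smul (D : Set (EuclideanSpace ℝ (Fin 2))) (c : ℝ) (u : ℝ × ℝ) (hc : 0 ≤ c) :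
    supportFn D (c • u) = c * supportFn D u := by
  have : planeForm (c • u) '' D = c • (planeForm u '' D) := by
    rw [← Set.image_smul, Set.image_image]
    congr 1
    ext d
    simp only [planeForm, Prod.smul_fst, Prod.smul_snd, smul_eq_mul]; ring
  rw [supportFn, this, Real.sSup_smul_of_nonneg hc, smul_eq_mul, supportFn]

theorem IsConvexBody.neg_supportFn_neg_le (hD : IsConvexBody D) (u : ℝ × ℝ)
    {d : EuclideanSpace ℝ (Fin 2)} (hd : d ∈ D) : -supportFn D (-u) ≤ planeForm u d := by
  have := hD.planeForm_le (-u) hd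
  rw [planeForm_neg] at this
  linarith

theorem IsConvexBody.width_pos (hD : IsConvexBody D) {u : ℝ × ℝ} (hu : u ≠ 0) :
    0 < supportFn D u + supportFn D (-u) := by
  obtain ⟨d, hd⟩ := hD.nonempty_interior
  have hcont : Filter.Tendsto (fun ε : ℝ => d + ε • !₂[u.1, u.2]) (nhdsWithin 0 (Set.Ioi 0))
      (nhds d) := by
    have : Continuous (fun ε : ℝ => d + ε • !₂[u.1, u.2]) := by fun_prop
    have h := this.tendsto 0
    simp only [zero_smul, add_zero] at h
    exact h.mono_left nhdsWithin_le_nhds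
  obtain ⟨ε, h1, h2⟩ := ((hcont.eventually (isOpen_interior.mem_nhds hd)).and
    self_mem_nhdsWithin).exists
  have h3 := hD.planeForm_le u (interior_subset h1)
  have h4 := hD.neg_supportFn_neg_le u (interior_subset hd)
  rw [planeForm_add, planeForm_smul] at h3
  have h5 : 0 < planeForm u !₂[u.1, u.2] := by
    simp only [planeForm, Matrix.cons_val_zero, Matrix.cons_val_one]
    by_contra! h
    apply hu
    ext <;> simp only [Prod.fst_zero, Prod.snd_zero] <;> nlinarith
  have := mul_pos (Set.mem_Ioi.1 h2) h5
  linarith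

/-- The linear inclusion of the plane. -/
theorem xyPlane_isLinearMap : IsLinearMap ℝ xyPlane where
  map_add p q := by ext i; fin_cases i <;> simp [xyPlane]
  map_smul c p := by ext i; fin_cases i <;> simp [xyPlane]

theorem mem_truncatedCone_iff (hD : IsConvexBody D) {x : EuclideanSpace ℝ (Fin 3)} :
    x ∈ truncatedCone D ↔ ∃ d ∈ D, ∃ τ : ℝ, 0 ≤ τ ∧ τ ≤ 1 ∧ x 0 = (1 - τ) * d 0 ∧
      x 1 = (1 - τ) * d 1 ∧ x 2 = τ := by
  have hconv : Convex ℝ (xyPlane '' D) := hD.convex.is_linear_image xyPlane_isLinearMap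
  rw [truncatedCone, Set.singleton_union, convexHull_insert (hD.nonempty.image _),
    hconv.convexHull_eq]
  simp only [convexJoin_singleton_left, Set.mem_iUnion, Set.mem_image, exists_prop,
    exists_exists_and_eq_and]
  refine exists_congr fun d => and_congr_right fun _ => ?_
  simp only [segment, Set.mem_ofPred_eq]
  constructor
  · rintro ⟨a, b, ha, hb, hab, rfl⟩
    have hb' : b = 1 - a := by linarith
    subst hb'
    refine ⟨a, ha, by linarith, ?_, ?_, ?_⟩ <;> simp [apex, xyPlane]
  · rintro ⟨τ, h0, h1, e0, e1, e2⟩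
    refine ⟨τ, 1 - τ, h0, by linarith, by ring, ?_⟩
    ext i
    fin_cases i <;> simp [apex, xyPlane, e0, e1, e2]

/-- Central projection from the apex to the base plane is continuous on the open slab, so the
preimage of `interior D` is an open subset of the cone. -/
theorem mem_interior_truncatedCone (hD : IsConvexBody D) {x : EuclideanSpace ℝ (Fin 3)}
    {d : EuclideanSpace ℝ (Fin 2)} (hd : d ∈ interior D) (h0 : 0 < x 2) (h1 : x 2 < 1)
    (e0 : x 0 = (1 - x 2) * d 0) (e1 : x 1 = (1 - x 2) * d 1) :
    x ∈ interior (truncatedCone D) := by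
  let F : EuclideanSpace ℝ (Fin 3) → EuclideanSpace ℝ (Fin 2) :=
    fun y => (1 - y 2)⁻¹ • !₂[y 0, y 1]
  let U : Set (EuclideanSpace ℝ (Fin 3)) := {y | 0 < y 2 ∧ y 2 < 1}
  have hU : IsOpen U := by
    have hc : Continuous fun y : EuclideanSpace ℝ (Fin 3) => y 2 := by fun_prop
    exact (isOpen_lt continuous_const hc).inter (isOpen_lt hc continuous_const)
  have hF : ContinuousOn F U := by
    refine ContinuousOn.fun_smul (ContinuousOn.inv₀ (by fun_prop) fun y hy => ?_) (by fun_prop)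
    exact (sub_pos.2 hy.2).ne'
  refine mem_interior.2 ⟨U ∩ F ⁻¹' interior D, ?_, hF.isOpen_inter_preimage hU isOpen_interior,
    ⟨h0, h1⟩, ?_⟩
  · rintro y ⟨hy, hy'⟩
    have : (1 - y 2) ≠ 0 := by have := hy.2; intro h; linarith
    refine (mem_truncatedCone_iff hD).2 ⟨F y, interior_subset hy', y 2, hy.1.le, hy.2.le, ?_, ?_, rfl⟩ <;>
      simp [F, mul_inv_cancel_left₀ this]
  · have hne : (1 - x 2) ≠ 0 := by intro h; linarith
    have : F x = d := by
      ext i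
      fin_cases i <;> simp [F, e0, e1, inv_mul_cancel_left₀ hne]
    rw [Set.mem_preimage, this]
    exact hd

theorem interior_translateBy {n : ℕ} (C : Set (EuclideanSpace ℝ (Fin n)))
    (v : EuclideanSpace ℝ (Fin n)) :
    interior (translateBy C v) = translateBy (interior C) v :=
  ((Homeomorph.addRight v).image_interior C).symm

/-- The value of the functional extending `u` at a translation vector. -/
noncomputable def coneForm (D : Set (EuclideanSpace ℝ (Fin 2))) (v : EuclideanSpace ℝ (Fin 3))
    (u : ℝ × ℝ) : ℝ :=
  (u.1 * v 0 + u.2 * v 1) + supportFn D u * v 2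

/-- Here `τ` and `σ` are the heights of a common point above the two bases; the bounds compare the
ranges of the functional on the two slices through it. -/
theorem exists_heights_of_touch (hD : IsConvexBody D) {v w : EuclideanSpace ℝ (Fin 3)}
    (h : (translateBy (truncatedCone D) v ∩ translateBy (truncatedCone D) w).Nonempty) :
    ∃ τ σ : ℝ, 0 ≤ τ ∧ τ ≤ 1 ∧ 0 ≤ σ ∧ σ ≤ 1 ∧ v 2 - w 2 = σ - τ ∧ ∀ u,
      coneForm D v u - coneForm D w u ≤ (1 - τ) * (supportFn D u + supportFn D (-u)) ∧
      coneForm D w u - coneForm D v u ≤ (1 - σ) * (supportFn D u + supportFn D (-u)) := by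
  obtain ⟨_, ⟨x, hx, rfl⟩, ⟨y, hy, hxy⟩⟩ := h
  obtain ⟨d, hd, τ, t0, t1, x0, x1, x2⟩ := (mem_truncatedCone_iff hD).1 hx
  obtain ⟨d', hd', σ, s0, s1, y0, y1, y2⟩ := (mem_truncatedCone_iff hD).1 hy
  have c := fun i => congrArg (fun p : EuclideanSpace ℝ (Fin 3) => p i) hxy
  simp only [PiLp.add_apply] at c
  have c0 := c 0
  have c1 := c 1
  have c2 := c 2
  rw [x0, y0] at c0
  rw [x1, y1] at c1
  rw [x2, y2] at c2
  refine ⟨τ, σ, t0, t1, s0, s1, by linarith, fun u => ?_⟩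
  have e : coneForm D v u - coneForm D w u =
      ((1 - σ) * planeForm u d' + σ * supportFn D u)
        - ((1 - τ) * planeForm u d + τ * supportFn D u) := by
    simp only [coneForm, planeForm]
    linear_combination (-u.1) * c0 - u.2 * c1 - supportFn D u * c2
  have a1 := mul_le_mul_of_nonneg_left (hD.planeForm_le u hd) (sub_nonneg.2 t1)
  have a2 := mul_le_mul_of_nonneg_left (hD.planeForm_le u hd') (sub_nonneg.2 s1)
  have a3 := mul_le_mul_of_nonneg_left (hD.neg_supportFn_neg_le u hd) (sub_nonneg.2 t1)
  have a4 := mul_le_mul_of_nonneg_left (hD.neg_supportFn_neg_le u hd') (sub_nonneg.2 s1)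
  constructor <;> linarith

theorem exists_separating (hD : IsConvexBody D) {v w : EuclideanSpace ℝ (Fin 3)}
    (h : interior (translateBy (truncatedCone D) v) ∩ interior (translateBy (truncatedCone D) w) = ∅)
    (hz : w 2 ≤ v 2) (h1 : v 2 - w 2 < 1) :
    ∃ u : ℝ × ℝ, u ≠ 0 ∧ supportFn D u + supportFn D (-u) ≤ coneForm D v u - coneForm D w u := by
  set η := v 2 - w 2 with hη
  set p : EuclideanSpace ℝ (Fin 2) := !₂[v 0, v 1] with hp
  set q : EuclideanSpace ℝ (Fin 2) := !₂[w 0, w 1] with hq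
  -- If the open base of the upper cone met the open slice of the lower cone at that height, moving
  -- by a small `ε` from the common point towards the upper apex would reach a common interior
  -- point. The point `d''` is its projection to the base of the lower cone, and is near `d'`.
  have hdisj : ∀ d ∈ interior D, ∀ d' ∈ interior D, p + d ≠ q + (1 - η) • d' := by
    intro d hd d' hd' heq
    have hcont : Filter.Tendsto (fun ε : ℝ => (1 - η - ε)⁻¹ • ((1 - η) • d' - ε • d))
        (nhdsWithin 0 (Set.Ioi 0)) (nhds d') := by
      have hc : ContinuousAt (fun ε : ℝ => (1 - η - ε)⁻¹ • ((1 - η) • d' - ε • d)) 0 := by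
        refine ContinuousAt.fun_smul (ContinuousAt.inv₀ (by fun_prop) ?_) (by fun_prop)
        intro h; linarith
      have h := hc.tendsto
      simp only [zero_smul, sub_zero, smul_smul] at h
      rw [inv_mul_cancel₀ (by intro h; linarith), one_smul] at h
      exact h.mono_left nhdsWithin_le_nhds
    have hsmall : ∀ᶠ ε : ℝ in nhdsWithin 0 (Set.Ioi 0), ε < 1 - η :=
      nhdsWithin_le_nhds (gt_mem_nhds (by linarith))
    obtain ⟨ε, ⟨h2, h3⟩, h4⟩ := (((hcont.eventually (isOpen_interior.mem_nhds hd')).and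
      hsmall).and self_mem_nhdsWithin).exists
    have h4 : 0 < ε := h4
    set d'' := (1 - η - ε)⁻¹ • ((1 - η) • d' - ε • d) with hd''
    have hne : 1 - η - ε ≠ 0 := by intro h; linarith
    have hd3 : (1 - η - ε) • d'' = (1 - η) • d' - ε • d := by
      rw [hd'', smul_smul, mul_inv_cancel₀ hne, one_smul]
    have k0 := congrArg (fun y : EuclideanSpace ℝ (Fin 2) => y 0) hd3
    have k1 := congrArg (fun y : EuclideanSpace ℝ (Fin 2) => y 1) hd3
    have l0 := congrArg (fun y : EuclideanSpace ℝ (Fin 2) => y 0) heq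
    have l1 := congrArg (fun y : EuclideanSpace ℝ (Fin 2) => y 1) heq
    simp [hp, hq] at k0 k1 l0 l1
    have m1 : !₂[(1 - ε) * d 0, (1 - ε) * d 1, ε] ∈ interior (truncatedCone D) :=
      mem_interior_truncatedCone hD hd (by simpa using h4) (by simp; linarith) (by simp)
        (by simp)
    have m2 : !₂[(1 - (η + ε)) * d'' 0, (1 - (η + ε)) * d'' 1, η + ε] ∈
        interior (truncatedCone D) :=
      mem_interior_truncatedCone hD h2 (by simp; linarith) (by simp; linarith)
        (by simp) (by simp)
    rw [interior_translateBy, interior_translateBy] at h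
    refine Set.eq_empty_iff_forall_notMem.1 h _ ⟨⟨_, m1, rfl⟩, ⟨_, m2, ?_⟩⟩
    ext i
    fin_cases i <;> simp <;> linarith
  obtain ⟨d₀, hd₀⟩ := hD.nonempty_interior
  have hint : Convex ℝ (interior D) := hD.convex.interior
  obtain ⟨f, c, hA, hB⟩ := geometric_hahn_banach_open
    (s := (fun d => p + d) '' interior D) (t := (fun d => q + (1 - η) • d) '' interior D)
    (hint.translate p) ((Homeomorph.addLeft p).isOpenMap _ isOpen_interior)
    (by
      have := (hint.smul (1 - η)).translate q
      rw [← Set.image_smul, Set.image_image] at this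
      exact this)
    (by
      rw [Set.disjoint_left]
      rintro _ ⟨d, hd, rfl⟩ ⟨d', hd', he⟩
      exact hdisj d hd d' hd' he.symm)
  -- The separation theorem gives the upper base the smaller values of `f`; the sign makes `u` point
  -- towards it.
  set u : ℝ × ℝ := (-f (EuclideanSpace.single 0 1), -f (EuclideanSpace.single 1 1)) with hu
  have hf : ∀ x, f x = -planeForm u x := by
    intro x
    have : x = x 0 • EuclideanSpace.single 0 (1 : ℝ) + x 1 • EuclideanSpace.single 1 (1 : ℝ) := by
      ext i
      fin_cases i <;> simp
    conv_lhs => rw [this]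
    simp only [map_add, map_smul, smul_eq_mul, planeForm, hu]
    ring
  have hA' : ∀ d ∈ interior D, -c ≤ planeForm u p + planeForm u d := by
    intro d hd
    have := hA _ ⟨d, hd, rfl⟩
    simp only [hf, planeForm_add] at this
    linarith
  have hB' : ∀ d ∈ interior D, planeForm u q + (1 - η) * planeForm u d ≤ -c := by
    intro d hd
    have := hB _ ⟨d, hd, rfl⟩
    simp only [hf, planeForm_add, planeForm_smul] at this
    linarith
  have hcl : ∀ P : EuclideanSpace ℝ (Fin 2) → Prop, IsClosed {d | P d} →
      (∀ d ∈ interior D, P d) → ∀ d ∈ D, P d := by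
    intro P hP hi d hd
    have h2 : closure (interior D) ⊆ {d | P d} := closure_minimal hi hP
    rw [hD.convex.closure_interior_eq_closure_of_nonempty_interior hD.nonempty_interior] at h2
    exact h2 (subset_closure hd)
  have hcf := continuous_planeForm u
  have hA2 := hcl _ (isClosed_le continuous_const (by fun_prop)) hA'
  have hB2 := hcl _ (isClosed_le (by fun_prop) continuous_const) hB'
  refine ⟨u, ?_, ?_⟩
  · intro h0
    have a1 := hA _ ⟨d₀, hd₀, rfl⟩
    have b1 := hB _ ⟨d₀, hd₀, rfl⟩
    rw [hf, h0] at a1 b1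
    simp [planeForm] at a1 b1
    linarith
  · have s1 : supportFn D (-u) ≤ planeForm u p + c := hD.supportFn_le fun d hd => by
      rw [planeForm_neg]; linarith [hA2 d hd]
    have s2 : supportFn D u ≤ (-c - planeForm u q) / (1 - η) := hD.supportFn_le fun d hd => by
      rw [le_div_iff₀ (by linarith)]; linarith [hB2 d hd]
    rw [le_div_iff₀ (by linarith)] at s2
    have e1 : planeForm u p = u.1 * v 0 + u.2 * v 1 := by simp [planeForm, hp]
    have e2 : planeForm u q = u.1 * w 0 + u.2 * w 1 := by simp [planeForm, hq]
    simp only [coneForm, ← e1, ← e2]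
    have : supportFn D u * η = supportFn D u * v 2 - supportFn D u * w 2 := by rw [hη]; ring
    linarith

/-- The touching system of a family of pairwise touching translates of a truncated cone. -/
noncomputable def PairwiseTouching.touchSystem (hD : IsConvexBody D) {m : ℕ}
    {v : Fin m → EuclideanSpace ℝ (Fin 3)} (hv : PairwiseTouching (truncatedCone D) v) :
    TouchSystem (Fin m) where
  h := supportFn D
  L i :=
    { toFun := fun u => u.1 * v i 0 + u.2 * v i 1
      map_add' := fun u w => by simp only [Prod.fst_add, Prod.snd_add]; ring
      map_smul' := fun c u => by
        simp only [Prod.smul_fst, Prod.smul_snd, smul_eq_mul, RingHom.id_apply]; ring }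
  z i := v i 2
  sub' := hD.supportFn_add_le
  hom' := supportFn_smul D
  wpos' u hu := hD.width_pos hu
  up' i j u hz := by
    have hw : 0 ≤ supportFn D u + supportFn D (-u) := by
      obtain ⟨d, hd⟩ := hD.nonempty
      linarith [hD.planeForm_le u hd, hD.neg_supportFn_neg_le u hd]
    by_cases hij : i = j
    · subst hij; linarith
    · obtain ⟨τ, σ, t0, -, -, -, -, h⟩ := exists_heights_of_touch hD (hv i j hij).1
      have := (h u).1
      simp only [coneForm] at this
      exact this.trans (by nlinarith)
  dn' i j u hz := by
    have hw : 0 ≤ supportFn D u + supportFn D (-u) := by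
      obtain ⟨d, hd⟩ := hD.nonempty
      linarith [hD.planeForm_le u hd, hD.neg_supportFn_neg_le u hd]
    by_cases hij : i = j
    · subst hij; linarith
    · obtain ⟨τ, σ, t0, -, -, -, e, h⟩ := exists_heights_of_touch hD (hv i j hij).1
      have := (h u).2
      simp only [coneForm] at this
      rw [e]
      -- The height difference is `σ - τ ≤ σ`, because `τ` is nonnegative.
      exact this.trans (by nlinarith)
  le1 i j := by
    by_cases hij : i = j
    · subst hij; linarith
    · obtain ⟨τ, σ, t0, -, -, s1, e, -⟩ := exists_heights_of_touch hD (hv i j hij).1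
      linarith
  act' i j hij hz h1 := by
    obtain ⟨u, hu, h⟩ := exists_separating hD (hv i j hij).2 hz h1
    obtain ⟨τ, σ, t0, -, -, -, -, h'⟩ := exists_heights_of_touch hD (hv i j hij).1
    have h2 := (h' u).1
    have hw := hD.width_pos hu
    simp only [coneForm] at h h2
    refine ⟨u, hu, le_antisymm (h2.trans (by nlinarith)) h⟩

theorem not_pairwiseTouching_six (hD : IsConvexBody D) (v : Fin 6 → EuclideanSpace ℝ (Fin 3)) :
    ¬ PairwiseTouching (truncatedCone D) v := by
  intro hv
  let S := hv.touchSystem hD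
  refine S.false_of_six (Tuple.sort fun i => -S.z i) (Equiv.injective _) fun a b hab => ?_
  exact neg_le_neg_iff.1 (Tuple.monotone_sort (fun i => -S.z i) hab)

end cone

theorem mainTheorem11 (D : Set (EuclideanSpace ℝ (Fin 2))) (hD : IsConvexBody D) :
    touchingNumber (truncatedCone D) ≤ 5 := by
  refine sSup_le ?_
  rintro _ ⟨m, rfl, v, hv⟩
  by_contra! hm
  have hm : 6 ≤ m := by
    have : 5 < m := by exact_mod_cast hm
    exact this
  exact not_pairwiseTouching_six hD (v ∘ Fin.castLE hm) fun i j hij =>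
    hv _ _ ((Fin.castLE_injective hm).ne hij)
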